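/- All groups are finite. A subgroup $H$ of a group $G$ is modular in $G$ if it is a modular element of the lattice of subgroups of $G$, that is, $\langle X, H\cap Z\rangle=\langle X,H\rangle\cap Z$ for all subgroups $X\le Z\le G$, and $\langle H, Y\cap Z\rangle=\langle H,Y\rangle\cap Z$ for all subgroups $Y,Z\le G$ with $H\le Z$. A subgroup $H$ of $G$ is submodular in $G$ if there is a chain of subgroups $H=H_0\le H_1\le\dots\le H_n=G$ such that $H_i$ is modular in $H_{i+1}$ for every $i<n$. Let $\mathfrak Z$ be the class of all groups in which every Sylow subgroup is submodular, and let $\mathcal A_1$ be the class of all groups of square-free exponent all of whose Sylow subgroups are abelian. For a group $X$, let $F(X)$ denote the Fitting subgroup of $X$ (its largest nilpotent normal subgroup), and let $X^{\mathcal A_1}$ denote the intersection of all normal subgroups $N$ of $X$ with $X/N\in\mathcal A_1$. Theorem. Let $A$ and $B$ be submodular subgroups of a group $G=AB$ and let $A,B\in\mathfrak Z$. Then $G\in\mathfrak Z$ if at least one of the following conditions holds: (1) the indices $|G:AF(G)|$ and $|G:BF(G)|$ are coprime; (2) the orders $|A/A^{\mathcal A_1}|$ and $|B/B^{\mathcal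 A_1}|$ are coprime. -/

import Mathlib

universe u

open scoped Pointwise

/-- `m` is a modular element of the lattice `L`. -/
def IsModularElement {L : Type u} [Lattice L] (m : L) : Prop :=
  (∀ x z : L, x ≤ z → x ⊔ (m ⊓ z) = (x ⊔ m) ⊓ z) ∧
  (∀ y z : L, m ≤ z → m ⊔ (y ⊓ z) = (m ⊔ y) ⊓ z)

/-- `H` is a modular subgroup of `G`: a modular element of the subgroup lattice of `G`. -/
def IsModularSubgroup {G : Type u} [Group G] (H : Subgroup G) : Prop :=
  IsModularElement H

/-- `H` is submodular in `G`: there is a chain `H = H₀ ≤ H₁ ≤ ... ≤ Hₙ = G` with each `Hᵢ` a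
modular subgroup of the group `Hᵢ₊₁`. -/
def IsSubmodular {G : Type u} [Group G] (H : Subgroup G) : Prop :=
  ∃ (n : ℕ) (K : ℕ → Subgroup G), K 0 = H ∧ K n = ⊤ ∧
    ∀ i < n, K i ≤ K (i + 1) ∧ IsModularSubgroup ((K i).subgroupOf (K (i + 1)))

/-- The class of groups all of whose Sylow subgroups are submodular. -/
def HasSubmodularSylows (G : Type u) [Group G] : Prop :=
  ∀ p : ℕ, p.Prime → ∀ P : Sylow p G, IsSubmodular (P : Subgroup G)

/-- The class `𝒜₁` of groups with abelian Sylow subgroups and square-free exponent. -/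
def IsSquarefreeA (G : Type u) [Group G] : Prop :=
  (∀ p : ℕ, p.Prime → ∀ P : Sylow p G, ∀ x ∈ P, ∀ y ∈ P, x * y = y * x) ∧
  Squarefree (Monoid.exponent G)

/-- The `𝔛`-residual of `G`: the intersection of all normal subgroups `N` of `G` with
`G ⧸ N` in the class `𝔛`. -/
def formationResidual (𝔛 : (H : Type u) → [Group H] → Prop) (G : Type u) [Group G] : Subgroup G :=
  sInf {N : Subgroup G | ∃ _ : N.Normal, 𝔛 (G ⧸ N)}

/-- The Fitting subgroup: the subgroup generated by (for finite `G`, the largest of) the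
nilpotent normal subgroups of `G`. -/
def fittingSubgroup (G : Type u) [Group G] : Subgroup G :=
  sSup {N : Subgroup G | N.Normal ∧ Group.IsNilpotent N}

/-!
The proof is by induction on the order of `G`, factoring out normal subgroups, and rests on two
facts about a submodular subgroup `X` of prime power order.

* `IsSubmodular.exists_normal_isPGroup_ge`: if `X` is a `p`-group for the largest prime divisor `p`
  of `|G|`, then `X` lies in a normal `p`-subgroup of `G`.
* `IsSubmodular.commute_of_isPowerOrCommutator`: if `X` is a `q`-group, then the `q`-th powers and
  the commutators of `X` centralize every normal `p`-subgroup of `G` with `p ≠ q`.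

The first fact is proved along a chain of links that are normal or maximal
(`IsModularSubgroup.exists_ge_normal_or_isCoatom`), and there it suffices that the core of a modular
maximal subgroup `M` contains all `p`-subgroups of `M`. If `M` has trivial core, then every subgroup
`Y` is contained in a given conjugate of `M` or meets it in a maximal subgroup of `Y`, and the
conjugates have trivial intersection. This makes the Sylow subgroups of `G` abelian and, for the
smallest prime divisor, central in their normalizers, so that Burnside's transfer theorem and
induction yield a normal Sylow `p`-subgroup (`sylow_normal_of_sInf_eq_bot`), which meets `M`
trivially. The second fact is a direct computation with the modular laws: they make a modular
subgroup `M` normalize every subgroup between `M ⊓ P` and the normal `p`-subgroup `P`.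

Now let `G = AB` be as in the theorem. By the first fact the Sylow `p`-subgroups of `A` and `B`, for
the largest prime divisor `p` of `|G|`, lie in a normal `p`-subgroup `O`, which is then a Sylow
subgroup of `G`. If `G` has a normal subgroup `K ≠ 1` of order prime to `p`, then `G / O` and
`G / K` belong to the class by induction, hence so does `G`, because `O ∩ K = 1`. Otherwise `O`
contains its centralizer (again by Burnside) and the Fitting subgroup. It remains to see that a
prime `q ≠ p` does not divide both `|G : A|` and `|G : B|`: then a Sylow `q`-subgroup of `A` or of
`B` is a submodular Sylow subgroup of `G`. For coprime `|G : A F(G)|` and `|G : B F(G)|` this holds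
since `F(G) ≤ O` is a `p`-group. For the residuals, the second fact gives
`A / (A ∩ O), B / (B ∩ O) ∈ 𝒜₁`, so the residuals of `A` and `B` lie in `O`, and `q` fails to divide
one of `|A|` and `|B|`, which are multiples of `|G : B|` and `|G : A|`.
-/

/-! ### Modular elements of lattices -/

/-- `h` satisfies the two modular laws inside the lower interval of `k`. For `h ≤ k` this says that
`h` is a modular element of the lattice `Set.Iic k`; for subgroups it expresses modularity of `h`
in the group `k` without changing the ambient group. -/
def IsModularBelow {L : Type*} [Lattice L] (h k : L) : Prop :=
  (∀ x z : L, x ≤ z → z ≤ k → x ⊔ (h ⊓ z) = (x ⊔ h) ⊓ z) ∧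
  (∀ y z : L, y ≤ k → z ≤ k → h ≤ z → h ⊔ (y ⊓ z) = (h ⊔ y) ⊓ z)

section Lattice

variable {L : Type*} [Lattice L]

/-- Intersecting with `l` preserves modularity. For the second law, `y ⊓ z = y ⊓ (z ⊔ h)` whenever
`y ≤ l` and `h ⊓ l ≤ z ≤ l`, which reduces it to the second law for `h` at `z ⊔ h`. -/
theorem IsModularBelow.inf_right {h k : L} (hhk : h ≤ k) (H : IsModularBelow h k) (l : L) :
    IsModularBelow (h ⊓ l) (k ⊓ l) := by
  obtain ⟨H1, H2⟩ := H
  refine ⟨fun x z hxz hz => ?_, fun y z hy hz hhz => ?_⟩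
  · have hzk := hz.trans inf_le_left
    have hzl := hz.trans inf_le_right
    have e1 : h ⊓ l ⊓ z = h ⊓ z := by rw [inf_assoc, inf_eq_right.2 hzl]
    apply le_antisymm
    · exact le_inf (sup_le_sup_left inf_le_left _) (sup_le hxz inf_le_right)
    · rw [e1, H1 x z hxz hzk]
      exact inf_le_inf_right _ (sup_le_sup_left inf_le_left _)
  · have hzk := hz.trans inf_le_left
    have hzl := hz.trans inf_le_right
    have hyk := hy.trans inf_le_left
    have hyl := hy.trans inf_le_right
    have e1 : h ⊓ l = h ⊓ z := le_antisymm (le_inf inf_le_left hhz) (inf_le_inf_left _ hzl)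
    have e2 : y ⊓ (z ⊔ h) = y ⊓ z := by
      apply le_antisymm
      · refine le_inf inf_le_left ?_
        have e3 : (z ⊔ h) ⊓ (k ⊓ l) = z ⊔ (h ⊓ (k ⊓ l)) := (H1 z (k ⊓ l) hz inf_le_left).symm
        calc y ⊓ (z ⊔ h) ≤ (z ⊔ h) ⊓ (k ⊓ l) := le_inf inf_le_right (inf_le_left.trans hy)
          _ = z ⊔ (h ⊓ (k ⊓ l)) := e3
          _ ≤ z := sup_le le_rfl ((inf_le_inf_left _ inf_le_right).trans hhz)
      · exact inf_le_inf_left _ le_sup_left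
    apply le_antisymm
    · exact le_inf (sup_le_sup_left inf_le_left _) (sup_le hhz inf_le_right)
    · have e4 := H2 y (z ⊔ h) hyk (sup_le hzk hhk) le_sup_right
      rw [e2] at e4
      have e5 := H1 (y ⊓ z) z inf_le_right hzk
      calc (h ⊓ l ⊔ y) ⊓ z ≤ ((h ⊔ y) ⊓ (z ⊔ h)) ⊓ z :=
            le_inf (le_inf (inf_le_left.trans (sup_le_sup_right inf_le_left _))
              (inf_le_right.trans le_sup_left)) inf_le_right
        _ = (y ⊓ z ⊔ h) ⊓ z := by rw [← e4, sup_comm h]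
        _ = y ⊓ z ⊔ h ⊓ z := e5.symm
        _ = h ⊓ l ⊔ y ⊓ z := by rw [e1, sup_comm]

/-- Joins of modular elements are modular. -/
theorem IsModularElement.sup {L : Type u} [Lattice L] {m n : L} (hm : IsModularElement m)
    (hn : IsModularElement n) : IsModularElement (m ⊔ n) := by
  obtain ⟨m1, m2⟩ := hm
  obtain ⟨n1, n2⟩ := hn
  refine ⟨fun x z hxz => ?_, fun y z hz => ?_⟩
  · apply le_antisymm
    · exact le_inf (sup_le_sup_left inf_le_left _) (sup_le hxz inf_le_right)
    · have e1 : (m ⊔ (n ⊔ x)) ⊓ (z ⊔ m) = m ⊔ (x ⊔ (n ⊓ (z ⊔ m))) := by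
        rw [← m2 _ _ le_sup_right, sup_comm n x, n1 x (z ⊔ m) (hxz.trans le_sup_left)]
      have e2 : m ⊔ (n ⊓ (z ⊔ m)) = m ⊔ (z ⊓ (m ⊔ n)) := by
        rw [m2 n _ le_sup_right, m2 z _ le_sup_left, sup_comm z m, inf_comm]
      have e3 := m1 (x ⊔ (m ⊔ n) ⊓ z) z (sup_le hxz inf_le_right)
      calc (x ⊔ (m ⊔ n)) ⊓ z ≤ ((m ⊔ (n ⊔ x)) ⊓ (z ⊔ m)) ⊓ z := by
            refine le_inf (le_inf (inf_le_left.trans ?_) (inf_le_right.trans le_sup_left))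
              inf_le_right
            rw [sup_comm x, sup_assoc]
        _ = (x ⊔ (m ⊔ (n ⊓ (z ⊔ m)))) ⊓ z := by rw [e1, sup_left_comm]
        _ = ((x ⊔ (m ⊔ n) ⊓ z) ⊔ m) ⊓ z := by
            rw [e2, sup_comm m, inf_comm z, ← sup_assoc]
        _ ≤ x ⊔ (m ⊔ n) ⊓ z := by
            rw [← e3]
            exact sup_le le_rfl (le_sup_of_le_right (inf_le_inf_right _ le_sup_left))
  · rw [sup_assoc, n2 _ _ (le_sup_right.trans hz), m2 _ _ (le_sup_left.trans hz), sup_assoc]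

end Lattice

/-! ### Submodular subgroups -/

/-- One link of a submodular chain: `H` is contained and modular in the group `K`. -/
def ModularIn {G : Type*} [Group G] (H K : Subgroup G) : Prop :=
  H ≤ K ∧ IsModularBelow H K

/-- `H` is linked to `K` by a chain of subgroups, each modular in the next. -/
def SubmodularIn {G : Type*} [Group G] (H K : Subgroup G) : Prop :=
  Relation.ReflTransGen ModularIn H K

section

variable {G : Type u} [Group G]

theorem isModularBelow_iff_subgroupOf {H K : Subgroup G} (hHK : H ≤ K) :
    IsModularBelow H K ↔ IsModularSubgroup (H.subgroupOf K) := by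
  have hs : ∀ {X Y : Subgroup K}, X.map K.subtype ⊔ Y.map K.subtype = (X ⊔ Y).map K.subtype :=
    fun {X Y} => (Subgroup.map_sup X Y _).symm
  have hi : ∀ {X Y : Subgroup K}, X.map K.subtype ⊓ Y.map K.subtype = (X ⊓ Y).map K.subtype :=
    fun {X Y} => (Subgroup.map_inf X Y _ K.subtype_injective).symm
  have inj := Subgroup.map_injective K.subtype_injective
  have hH : (H.subgroupOf K).map K.subtype = H := Subgroup.map_subgroupOf_eq_of_le hHK
  constructor
  · rintro ⟨h1, h2⟩
    refine ⟨fun x z hxz => inj ?_, fun y z hz => inj ?_⟩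
    · have := h1 (x.map K.subtype) (z.map K.subtype) (Subgroup.map_mono hxz)
        (Subgroup.map_subtype_le z)
      rwa [← hH, hi, hs, hs, hi] at this
    · have := h2 (y.map K.subtype) (z.map K.subtype) (Subgroup.map_subtype_le y)
        (Subgroup.map_subtype_le z) (by rw [← hH]; exact Subgroup.map_mono hz)
      rwa [← hH, hi, hs, hs, hi] at this
  · rintro ⟨h1, h2⟩
    refine ⟨fun x z hxz hz => ?_, fun y z hy hz hhz => ?_⟩
    · have := h1 (x.subgroupOf K) (z.subgroupOf K) (Subgroup.comap_mono hxz)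
      apply_fun Subgroup.map K.subtype at this
      rwa [← hs, ← hi, ← hi, ← hs, hH, Subgroup.map_subgroupOf_eq_of_le hz,
        Subgroup.map_subgroupOf_eq_of_le (hxz.trans hz)] at this
    · have := h2 (y.subgroupOf K) (z.subgroupOf K) (Subgroup.comap_mono hhz)
      apply_fun Subgroup.map K.subtype at this
      rwa [← hs, ← hi, ← hi, ← hs, hH, Subgroup.map_subgroupOf_eq_of_le hz,
        Subgroup.map_subgroupOf_eq_of_le hy] at this

theorem isModularSubgroup_iff_modularIn_top {H : Subgroup G} :
    IsModularSubgroup H ↔ ModularIn H ⊤ :=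
  ⟨fun h => ⟨le_top, fun x z hxz _ => h.1 x z hxz, fun y z _ _ hz => h.2 y z hz⟩,
    fun h => ⟨fun x z hxz => h.2.1 x z hxz le_top, fun y z hz => h.2.2 y z le_top le_top hz⟩⟩

theorem isSubmodular_iff_submodularIn_top {H : Subgroup G} :
    IsSubmodular H ↔ SubmodularIn H ⊤ := by
  constructor
  · rintro ⟨n, K, h0, hn, hK⟩
    have : ∀ i ≤ n, SubmodularIn H (K i) := by
      intro i
      induction i with
      | zero => intro _; rw [h0]; exact Relation.ReflTransGen.refl
      | succ i ih =>
        intro hi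
        have := hK i (by omega)
        exact (ih (by omega)).tail ⟨this.1, (isModularBelow_iff_subgroupOf this.1).2 this.2⟩
    exact hn ▸ this n le_rfl
  · intro h
    have : ∀ {H K : Subgroup G}, SubmodularIn H K → ∃ (n : ℕ) (C : ℕ → Subgroup G), C 0 = H ∧
        C n = K ∧ ∀ i < n, C i ≤ C (i + 1) ∧
          IsModularSubgroup ((C i).subgroupOf (C (i + 1))) := by
      intro H K h
      induction h using Relation.ReflTransGen.head_induction_on with
      | refl => exact ⟨0, fun _ => K, rfl, rfl, fun i hi => absurd hi (Nat.not_lt_zero i)⟩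
      | @head a c hac _ ih =>
        obtain ⟨n, C, h0, hn, hC⟩ := ih
        refine ⟨n + 1, fun i => Nat.casesOn i a C, rfl, hn, fun i hi => ?_⟩
        cases i with
        | zero =>
          change a ≤ C 0 ∧ IsModularSubgroup (a.subgroupOf (C 0))
          rw [h0]
          exact ⟨hac.1, (isModularBelow_iff_subgroupOf hac.1).1 hac.2⟩
        | succ i => exact hC i (by omega)
    exact this h

theorem SubmodularIn.trans {H K M : Subgroup G} (h₁ : SubmodularIn H K) (h₂ : SubmodularIn K M) :
    SubmodularIn H M :=
  Relation.ReflTransGen.trans h₁ h₂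

theorem ModularIn.inf {H K : Subgroup G} (h : ModularIn H K) (M : Subgroup G) :
    ModularIn (H ⊓ M) (K ⊓ M) :=
  ⟨inf_le_inf_right M h.1, h.2.inf_right h.1 M⟩

variable {G' : Type*} [Group G']

theorem Subgroup.map_inf_comap' (f : G →* G') (H : Subgroup G) (K : Subgroup G') :
    (H ⊓ K.comap f).map f = H.map f ⊓ K :=
  SetLike.coe_injective (by simp [Set.image_inter_preimage])

theorem ModularIn.map {H K : Subgroup G} (h : ModularIn H K) (f : G →* G') :
    ModularIn (H.map f) (K.map f) := by
  obtain ⟨hHK, h1, h2⟩ := h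
  have key : ∀ {x : Subgroup G'}, x ≤ K.map f → (K ⊓ x.comap f).map f = x := fun {x} hx => by
    rw [Subgroup.map_inf_comap', inf_eq_right.2 hx]
  refine ⟨Subgroup.map_mono hHK, fun x z hxz hz => ?_, fun y z hy hz hhz => ?_⟩
  · have := h1 (K ⊓ x.comap f) (K ⊓ z.comap f) (inf_le_inf_left _ (Subgroup.comap_mono hxz))
      inf_le_left
    have e1 : H ⊓ (K ⊓ z.comap f) = H ⊓ z.comap f := by
      rw [← inf_assoc, inf_eq_left.2 hHK]
    have e2 : (K ⊓ x.comap f ⊔ H) ⊓ (K ⊓ z.comap f) = (K ⊓ x.comap f ⊔ H) ⊓ z.comap f := by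
      rw [← inf_assoc, inf_eq_left.2 (sup_le inf_le_left hHK)]
    rw [e1, e2] at this
    apply_fun Subgroup.map f at this
    rwa [Subgroup.map_sup, Subgroup.map_inf_comap' f H, Subgroup.map_inf_comap' f (_ ⊔ _),
      Subgroup.map_sup, key (hxz.trans hz)] at this
  · have := h2 (K ⊓ y.comap f) (K ⊓ z.comap f) inf_le_left inf_le_left
      (le_inf hHK (Subgroup.map_le_iff_le_comap.1 hhz))
    have e1 : K ⊓ y.comap f ⊓ (K ⊓ z.comap f) = K ⊓ (y ⊓ z).comap f := by
      rw [Subgroup.comap_inf, ← inf_inf_distrib_left]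
    have e2 : (H ⊔ K ⊓ y.comap f) ⊓ (K ⊓ z.comap f) = (H ⊔ K ⊓ y.comap f) ⊓ z.comap f := by
      rw [← inf_assoc, inf_eq_left.2 (sup_le hHK inf_le_left)]
    rw [e1, e2] at this
    apply_fun Subgroup.map f at this
    rwa [Subgroup.map_sup, Subgroup.map_inf_comap' f (_ ⊔ _), Subgroup.map_sup,
      key (inf_le_left.trans hy), key hy] at this

/-- Preimages of modular subgroups are modular. After replacing `H`, `K` by their intersections
with the range of `f`, an element of `(X ⊔ comap H) ⊓ Z` differs from one of `X ⊔ (comap H ⊓ Z)`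
by an element of `ker f ⊓ Z`. -/
theorem ModularIn.comap {H K : Subgroup G'} (h : ModularIn H K) (f : G →* G') :
    ModularIn (H.comap f) (K.comap f) := by
  obtain ⟨hHK, h1, h2⟩ := h.inf f.range
  have hm : ∀ H : Subgroup G', (H.comap f).map f = H ⊓ f.range := fun H => by
    rw [Subgroup.map_comap_eq, inf_comm]
  have hzK : ∀ {z : Subgroup G}, z ≤ K.comap f → z.map f ≤ K ⊓ f.range := fun {z} hz => by
    rw [← hm]; exact Subgroup.map_mono hz
  have hinf : ∀ (H : Subgroup G') (z : Subgroup G),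
      (H ⊓ f.range) ⊓ z.map f = (z ⊓ H.comap f).map f := fun H z => by
    rw [Subgroup.map_inf_comap', inf_comm, ← inf_assoc,
      inf_eq_left.2 (inf_le_left.trans (Subgroup.map_le_range f z)), inf_comm]
  have hker : f.ker ≤ H.comap f := Subgroup.ker_le_comap f H
  refine ⟨Subgroup.comap_mono h.1, fun x z hxz hz => ?_, fun y z hy hz hhz => ?_⟩
  · apply le_antisymm
    · exact le_inf (sup_le_sup_left inf_le_left _) (sup_le hxz inf_le_right)
    · rintro t ⟨ht1, ht2⟩
      have e := h1 (x.map f) (z.map f) (Subgroup.map_mono hxz) (hzK hz)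
      rw [hinf, ← Subgroup.map_sup] at e
      have ht : f t ∈ (x.map f ⊔ H ⊓ f.range) ⊓ z.map f := by
        refine ⟨?_, Subgroup.mem_map_of_mem f ht2⟩
        rw [← hm, ← Subgroup.map_sup]
        exact Subgroup.mem_map_of_mem f ht1
      rw [← e] at ht
      obtain ⟨u, hu, hut⟩ := ht
      have hxu : x ⊔ z ⊓ H.comap f ≤ x ⊔ H.comap f ⊓ z := by rw [inf_comm]
      have hu' := hxu hu
      have huz : u ∈ z := (sup_le hxz inf_le_right : x ⊔ H.comap f ⊓ z ≤ z) hu'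
      have hk : u⁻¹ * t ∈ f.ker := by simp [MonoidHom.mem_ker, hut]
      have : u⁻¹ * t ∈ x ⊔ H.comap f ⊓ z :=
        (le_sup_right : _ ≤ x ⊔ _) ⟨hker hk, z.mul_mem (z.inv_mem huz) ht2⟩
      simpa using mul_mem hu' this
  · apply le_antisymm
    · exact le_inf (sup_le_sup_left inf_le_left _) (sup_le hhz inf_le_right)
    · rintro t ⟨ht1, ht2⟩
      have e := h2 (y.map f) (z.map f) (hzK hy) (hzK hz) (by rw [← hm]; exact Subgroup.map_mono hhz)
      have e2 : y.map f ⊓ z.map f = (y ⊓ z).map f := by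
        have : z = (z.map f).comap f := by
          rw [Subgroup.comap_map_eq, sup_eq_left.2 (hker.trans hhz)]
        conv_rhs => rw [this]
        rw [Subgroup.map_inf_comap']
      rw [e2, ← hm, ← Subgroup.map_sup, ← Subgroup.map_sup] at e
      have ht : f t ∈ (H.comap f ⊔ y).map f ⊓ z.map f :=
        ⟨Subgroup.mem_map_of_mem f ht1, Subgroup.mem_map_of_mem f ht2⟩
      rw [← e] at ht
      obtain ⟨u, hu, hut⟩ := ht
      have hk : u⁻¹ * t ∈ f.ker := by simp [MonoidHom.mem_ker, hut]
      simpa using mul_mem hu ((le_sup_left : _ ≤ _ ⊔ y ⊓ z) (hker hk))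

/-- Normal subgroups are modular, by Dedekind's modular law. -/
theorem ModularIn.of_normal {H : Subgroup G} [H.Normal] : ModularIn H ⊤ := by
  refine ⟨le_top, fun x z hxz _ => ?_, fun y z _ _ hhz => ?_⟩
  · apply le_antisymm
    · exact le_inf (sup_le_sup_left inf_le_left _) (sup_le hxz inf_le_right)
    · rintro t ⟨ht, htz⟩
      obtain ⟨u, hu, v, hv, rfl⟩ := Subgroup.mem_sup_of_normal_right.1 ht
      exact Subgroup.mul_mem_sup hu ⟨hv, (z.mul_mem_cancel_left (hxz hu)).1 htz⟩
  · apply le_antisymm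
    · exact le_inf (sup_le_sup_left inf_le_left _) (sup_le hhz inf_le_right)
    · rintro t ⟨ht, htz⟩
      obtain ⟨u, hu, v, hv, rfl⟩ := Subgroup.mem_sup_of_normal_left.1 ht
      exact Subgroup.mul_mem_sup hu ⟨hv, (z.mul_mem_cancel_left (hhz hu)).1 htz⟩

theorem SubmodularIn.inf {H K : Subgroup G} (h : SubmodularIn H K) (M : Subgroup G) :
    SubmodularIn (H ⊓ M) (K ⊓ M) :=
  Relation.ReflTransGen.lift (· ⊓ M) (fun _ _ h => ModularIn.inf h M) _ _ h

theorem SubmodularIn.map {H K : Subgroup G} (h : SubmodularIn H K) (f : G →* G') :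
    SubmodularIn (H.map f) (K.map f) :=
  Relation.ReflTransGen.lift (Subgroup.map f) (fun _ _ h => ModularIn.map h f) _ _ h

theorem SubmodularIn.comap {H K : Subgroup G'} (h : SubmodularIn H K) (f : G →* G') :
    SubmodularIn (H.comap f) (K.comap f) :=
  Relation.ReflTransGen.lift (Subgroup.comap f) (fun _ _ h => ModularIn.comap h f) _ _ h

theorem IsSubmodular.map {G' : Type u} [Group G'] {H : Subgroup G} (h : IsSubmodular H)
    {f : G →* G'} (hf : Function.Surjective f) : IsSubmodular (H.map f) := by
  rw [isSubmodular_iff_submodularIn_top] at h ⊢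
  simpa [Subgroup.map_top_of_surjective f hf] using h.map f

theorem IsSubmodular.comap {G' : Type u} [Group G'] {H : Subgroup G'} (h : IsSubmodular H)
    (f : G →* G') : IsSubmodular (H.comap f) := by
  rw [isSubmodular_iff_submodularIn_top] at h ⊢
  simpa using h.comap f

theorem IsSubmodular.of_normal {H : Subgroup G} [H.Normal] : IsSubmodular H :=
  isSubmodular_iff_submodularIn_top.2 (Relation.ReflTransGen.single ModularIn.of_normal)

theorem IsSubmodular.inf {H K : Subgroup G} (hH : IsSubmodular H) (hK : IsSubmodular K) :
    IsSubmodular (H ⊓ K) := by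
  rw [isSubmodular_iff_submodularIn_top] at *
  exact (by simpa using hH.inf K : SubmodularIn (H ⊓ K) K).trans hK

theorem IsSubmodular.map_subtype {K : Subgroup G} {H : Subgroup K} (hH : IsSubmodular H)
    (hK : IsSubmodular K) : IsSubmodular (H.map K.subtype) := by
  rw [isSubmodular_iff_submodularIn_top] at *
  have := hH.map K.subtype
  rw [← MonoidHom.range_eq_map, Subgroup.range_subtype] at this
  exact this.trans hK

end

/-! ### The class of groups with submodular Sylow subgroups -/

section

variable {G : Type u} [Group G]

theorem IsSubmodular.smul {H : Subgroup G} (h : IsSubmodular H) (g : G) :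
    IsSubmodular (MulAut.conj g • H) :=
  h.map (f := (MulAut.conj g).toMonoidHom) (MulAut.conj g).surjective

theorem HasSubmodularSylows.of_surjective {G' : Type u} [Group G'] [Finite G]
    (h : HasSubmodularSylows G) {f : G →* G'} (hf : Function.Surjective f) :
    HasSubmodularSylows G' := by
  intro p hp P
  have := Fact.mk hp
  obtain ⟨Q, rfl⟩ := Sylow.mapSurjective_surjective hf p P
  rw [Sylow.coe_mapSurjective]
  exact (h p hp Q).map hf

/-- Since all Sylow `p`-subgroups are conjugate, one submodular Sylow `p`-subgroup suffices. -/
theorem isSubmodular_sylow_of_isSubmodular [Finite G] {p : ℕ} (hp : p.Prime) {H : Subgroup G}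
    (hH : IsPGroup p H) (hi : ¬ p ∣ H.index) (hs : IsSubmodular H) (P : Sylow p G) :
    IsSubmodular (P : Subgroup G) := by
  have := Fact.mk hp
  obtain ⟨g, hg⟩ := MulAction.exists_smul_eq G (hH.toSylow hi) P
  rw [← hg, Sylow.coe_subgroup_smul, IsPGroup.toSylow_coe]
  exact hs.smul g

/-- The class of groups with submodular Sylow subgroups is closed under subdirect products: for a
Sylow subgroup `S` the intersection `S N₁ ∩ S N₂` is a `p`-group, hence equal to `S`. -/
theorem HasSubmodularSylows.of_inf_eq_bot [Finite G] {N₁ N₂ : Subgroup G} [N₁.Normal] [N₂.Normal]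
    (h : N₁ ⊓ N₂ = ⊥) (h₁ : HasSubmodularSylows (G ⧸ N₁)) (h₂ : HasSubmodularSylows (G ⧸ N₂)) :
    HasSubmodularSylows G := by
  intro p hp S
  have := Fact.mk hp
  have key : ∀ (N : Subgroup G) [N.Normal], HasSubmodularSylows (G ⧸ N) →
      ∃ T : Subgroup G, IsSubmodular T ∧ (S : Subgroup G) ≤ T ∧ ∀ t ∈ T, ∃ k, t ^ p ^ k ∈ N := by
    intro N _ hN
    have hs := hN p hp (S.mapSurjective (QuotientGroup.mk'_surjective N))
    refine ⟨_, hs.comap (QuotientGroup.mk' N), ?_, fun t ht => ?_⟩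
    · rw [← Subgroup.map_le_iff_le_comap, Sylow.coe_mapSurjective]
    · obtain ⟨k, hk⟩ := (S.mapSurjective (QuotientGroup.mk'_surjective N)).isPGroup'
        ⟨_, Subgroup.mem_comap.1 ht⟩
      refine ⟨k, (QuotientGroup.eq_one_iff _).1 ?_⟩
      exact congrArg Subtype.val hk
  obtain ⟨T₁, hT₁, hS₁, hk₁⟩ := key N₁ h₁
  obtain ⟨T₂, hT₂, hS₂, hk₂⟩ := key N₂ h₂
  have hT : IsPGroup p (T₁ ⊓ T₂ : Subgroup G) := by
    rintro ⟨t, ht₁, ht₂⟩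
    obtain ⟨k₁, e₁⟩ := hk₁ t ht₁
    obtain ⟨k₂, e₂⟩ := hk₂ t ht₂
    refine ⟨k₁ + k₂, Subtype.ext ?_⟩
    have : t ^ p ^ (k₁ + k₂) ∈ N₁ ⊓ N₂ := by
      refine ⟨?_, ?_⟩
      · rw [pow_add, pow_mul]; exact N₁.pow_mem e₁ _
      · rw [add_comm, pow_add, pow_mul]; exact N₂.pow_mem e₂ _
    rw [h, Subgroup.mem_bot] at this
    simpa using this
  rw [← S.is_maximal' hT (le_inf hS₁ hS₂)]
  exact hT₁.inf hT₂

end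

/-! ### Maximal subgroups that are modular -/

/-- Every subgroup `Y` meets `M` in `Y` itself or in a maximal subgroup of `Y`. Modular maximal
subgroups have this property, and it passes to subgroups of the ambient group. -/
def MeetsMaximally {G : Type*} [Group G] (M : Subgroup G) : Prop :=
  ∀ X Y : Subgroup G, M ⊓ Y ≤ X → X ≤ Y → X = M ⊓ Y ∨ X = Y

section

variable {G : Type u} [Group G]

theorem IsModularSubgroup.meetsMaximally {M : Subgroup G} (hM : IsModularSubgroup M)
    (hc : IsCoatom M) : MeetsMaximally M := by
  intro X Y hX hXY
  have h := hM.1 X Y hXY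
  rw [sup_eq_left.2 hX] at h
  rcases hc.le_iff.1 (le_sup_right : M ≤ X ⊔ M) with h' | h'
  · rw [h', top_inf_eq] at h; exact Or.inr h
  · rw [h'] at h; exact Or.inl h

theorem MeetsMaximally.subgroupOf {M : Subgroup G} (hM : MeetsMaximally M) (K : Subgroup G) :
    MeetsMaximally (M.subgroupOf K) := by
  intro X Y hX hXY
  have inj := Subgroup.map_injective K.subtype_injective
  have e : (M.subgroupOf K ⊓ Y).map K.subtype = M ⊓ Y.map K.subtype := by
    rw [inf_comm, Subgroup.subgroupOf, Subgroup.map_inf_comap', inf_comm]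
  rcases hM (X.map K.subtype) (Y.map K.subtype) (e ▸ Subgroup.map_mono hX)
    (Subgroup.map_mono hXY) with h | h
  · exact Or.inl (inj (h.trans e.symm))
  · exact Or.inr (inj h)

theorem MeetsMaximally.smul {M : Subgroup G} (hM : MeetsMaximally M) (g : G) :
    MeetsMaximally (MulAut.conj g • M) := by
  intro X Y hX hXY
  have := hM ((MulAut.conj g)⁻¹ • X) ((MulAut.conj g)⁻¹ • Y)
    (by rw [Subgroup.subset_pointwise_smul_iff, inv_inv, Subgroup.smul_inf, smul_inv_smul]
        exact hX) (by rwa [Subgroup.pointwise_smul_le_pointwise_smul_iff])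
  rw [inv_smul_eq_iff, inv_smul_eq_iff, Subgroup.smul_inf, smul_inv_smul] at this
  exact this

/-- In a `p`-group the intersection with a maximally meeting subgroup is everything or a normal
subgroup of index `p`. -/
theorem MeetsMaximally.normal_and_index_eq [Finite G] {M : Subgroup G} (hM : MeetsMaximally M)
    {p : ℕ} [Fact p.Prime] {P : Subgroup G} (hP : IsPGroup p P) (hPM : ¬ P ≤ M) :
    (M.subgroupOf P).Normal ∧ (M.subgroupOf P).index = p := by
  have hc : IsCoatom (M.subgroupOf P) := by
    refine ⟨fun h => hPM (Subgroup.subgroupOf_eq_top.1 h), fun X hX => ?_⟩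
    rcases hM.subgroupOf P X ⊤ (by simpa using hX.le) le_top with h | h
    · rw [inf_top_eq] at h; exact absurd h hX.ne'
    · exact h
  have := hP.isNilpotent
  refine ⟨Subgroup.NormalizerCondition.normal_of_coatom _
    Group.normalizerCondition_of_isNilpotent hc, ?_⟩
  obtain ⟨n, hn⟩ := IsPGroup.iff_card.1 (hP.to_subgroup (M.subgroupOf P))
  obtain ⟨k, hk⟩ := hP.index (M.subgroupOf P)
  have hk0 : k ≠ 0 := fun h => hc.1 (Subgroup.index_eq_one.1 (by rw [hk, h, pow_zero]))
  have hcard := (M.subgroupOf P).card_mul_index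
  obtain ⟨K, hK, hle⟩ := Sylow.exists_subgroup_card_pow_succ (p := p) (n := n)
    (by rw [← hcard, hn, hk, pow_succ]; exact mul_dvd_mul_left _ (dvd_pow_self p hk0)) hn
  have hKt : K = ⊤ := by
    rcases hc.le_iff.1 hle with h | h
    · exact h
    · rw [h, hn] at hK
      exact absurd (Nat.pow_right_injective (Fact.out : p.Prime).two_le hK) (by omega)
  rw [hKt, Subgroup.card_top, ← hcard, hn, pow_succ] at hK
  exact Nat.eq_of_mul_eq_mul_left (pow_pos (Fact.out : p.Prime).pos n) hK

theorem MeetsMaximally.commutator_mem [Finite G] {M : Subgroup G} (hM : MeetsMaximally M)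
    {p : ℕ} [Fact p.Prime] {P : Subgroup G} (hP : IsPGroup p P) {x y : G} (hx : x ∈ P)
    (hy : y ∈ P) : x * y * x⁻¹ * y⁻¹ ∈ M := by
  by_cases hPM : P ≤ M
  · exact M.mul_mem (M.mul_mem (M.mul_mem (hPM hx) (hPM hy)) (M.inv_mem (hPM hx)))
      (M.inv_mem (hPM hy))
  obtain ⟨hn, hi⟩ := hM.normal_and_index_eq hP hPM
  have := isCyclic_of_prime_card (α := P ⧸ M.subgroupOf P) hi
  have e := (IsCyclic.commGroup (α := P ⧸ M.subgroupOf P)).mul_comm (QuotientGroup.mk ⟨x, hx⟩)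
    (QuotientGroup.mk ⟨y, hy⟩)
  have : (QuotientGroup.mk (⟨x, hx⟩ * ⟨y, hy⟩ * ⟨x, hx⟩⁻¹ * ⟨y, hy⟩⁻¹ : P) :
      P ⧸ M.subgroupOf P) = 1 := by
    rw [QuotientGroup.mk_mul, QuotientGroup.mk_mul, QuotientGroup.mk_mul, QuotientGroup.mk_inv,
      QuotientGroup.mk_inv]
    exact mul_inv_eq_one.2 (mul_inv_eq_of_eq_mul e)
  simpa [Subgroup.mem_subgroupOf] using (QuotientGroup.eq_one_iff _).1 this

/-- If `q` is at most every prime divisor of `|Γ|`, then `Γ` centralizes each normal section of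
order `q`, because the automorphism group of a group of order `q` has order `q - 1`. -/
theorem commutator_mem_of_relIndex_eq_prime {Γ : Type*} [Group Γ] [Finite Γ] {D A : Subgroup Γ}
    [D.Normal] [A.Normal] {q : ℕ} [Fact q.Prime] (hi : D.relIndex A = q)
    (hq : ∀ r, r.Prime → r ∣ Nat.card Γ → q ≤ r) (n : Γ) {x : Γ} (hx : x ∈ A) :
    n * x * n⁻¹ * x⁻¹ ∈ D := by
  let B := A.map (QuotientGroup.mk' D)
  have hB : Nat.card B = q := by
    rw [← hi, ← Subgroup.relIndex_ker, QuotientGroup.ker_mk']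
  have : B.Normal := inferInstance
  have := isCyclic_of_prime_card hB
  have hf : MulAut.conjNormal (QuotientGroup.mk' D n) = (1 : MulAut B) := by
    rw [← orderOf_eq_one_iff]
    by_contra hne
    have hr := Nat.minFac_prime hne
    have hd := Nat.minFac_dvd (orderOf (MulAut.conjNormal (QuotientGroup.mk' D n) : MulAut B))
    have h1 := hd.trans (orderOf_dvd_natCard _)
    rw [IsCyclic.card_mulAut, hB, Nat.totient_prime Fact.out] at h1
    have h2 := hq _ hr (hd.trans ((orderOf_map_dvd _ _).trans ((orderOf_map_dvd _ _).trans
      (orderOf_dvd_natCard n))))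
    have := Nat.le_of_dvd (Nat.sub_pos_of_lt (Fact.out : q.Prime).one_lt) h1
    have := (Fact.out : q.Prime).pos
    omega
  have := congrArg Subtype.val (DFunLike.congr_fun hf ⟨QuotientGroup.mk' D x, x, hx, rfl⟩)
  rw [MulAut.conjNormal_apply] at this
  refine (QuotientGroup.eq_one_iff _).1 ?_
  exact mul_inv_eq_one.2 this

theorem sup_le_normalizer_inf {G : Type*} [Group G] (M : Subgroup G) {Q : Subgroup G}
    (hcomm : ∀ x ∈ Q, ∀ y ∈ Q, x * y = y * x) :
    M ⊓ Subgroup.normalizer (Q : Set G) ⊔ Q ≤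
      Subgroup.normalizer ((M ⊓ Q : Subgroup G) : Set G) := by
  refine sup_le (fun m hm => ?_) (fun m hm => ?_)
  · refine Subgroup.mem_normalizer_iff.2 fun y => and_congr ?_ ?_
    · exact (Subgroup.mem_normalizer_iff.1 (Subgroup.le_normalizer (H := M) hm.1)) y
    · exact (Subgroup.mem_normalizer_iff.1 hm.2) y
  · refine Subgroup.mem_normalizer_iff.2 fun y => ⟨fun hy => ?_, fun hy => ?_⟩
    · rwa [hcomm m hm y hy.2, mul_inv_cancel_right]
    · have h2 := hcomm m hm _ hy.2
      rw [mul_assoc m y, mul_assoc m, mul_left_cancel_iff, inv_mul_cancel_right] at h2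
      rwa [mul_assoc, h2] at hy

/-- For the smallest prime `q`, the normalizer of an abelian `q`-subgroup acts on it trivially
modulo a maximally meeting subgroup. -/
theorem MeetsMaximally.commutator_normalizer_mem [Finite G] {M : Subgroup G}
    (hM : MeetsMaximally M) {q : ℕ} [Fact q.Prime]
    (hq : ∀ r, r.Prime → r ∣ Nat.card G → q ≤ r) {Q : Subgroup G} (hQ : IsPGroup q Q)
    (hcomm : ∀ x ∈ Q, ∀ y ∈ Q, x * y = y * x)
    {n x : G} (hn : n ∈ Subgroup.normalizer (Q : Set G)) (hx : x ∈ Q) : n * x * n⁻¹ * x⁻¹ ∈ M := by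
  by_cases hQM : Q ≤ M
  · exact M.mul_mem (hQM ((Subgroup.mem_normalizer_iff.1 hn x).1 hx)) (M.inv_mem (hQM hx))
  set N := Subgroup.normalizer (Q : Set G) with hN
  have hQN : Q ≤ N := Subgroup.le_normalizer
  have hD : ∀ m ∈ N, ∀ y ∈ M ⊓ Q, m * y * m⁻¹ ∈ M ⊓ Q := by
    have hsup : (M ⊓ N) ⊔ Q = N := by
      rcases hM ((M ⊓ N) ⊔ Q) N le_sup_left (sup_le inf_le_right hQN) with h | h
      · exact absurd ((le_sup_right.trans h.le).trans inf_le_left) hQM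
      · exact h
    have hle := sup_le_normalizer_inf M hcomm
    intro m hm y hy
    rw [← hsup] at hm
    exact (Subgroup.mem_normalizer_iff.1 (hle hm) y).1 hy
  have : ((M ⊓ Q).subgroupOf N).Normal :=
    ⟨fun y hy m => hD m m.2 y hy⟩
  have : (Q.subgroupOf N).Normal := Subgroup.normal_in_normalizer
  have hi : ((M ⊓ Q).subgroupOf N).relIndex (Q.subgroupOf N) = q := by
    rw [Subgroup.relIndex_subgroupOf hQN, Subgroup.inf_relIndex_right]
    exact (hM.normal_and_index_eq hQ hQM).2
  exact (commutator_mem_of_relIndex_eq_prime (D := (M ⊓ Q).subgroupOf N) (A := Q.subgroupOf N) hi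
    (fun r hr hd => hq r hr (hd.trans (Subgroup.card_subgroup_dvd_card N))) ⟨n, hn⟩
    (x := ⟨x, hQN hx⟩) hx).1

/-- Let a family of maximally meeting subgroups have trivial intersection. Then the Sylow
subgroups for the largest prime divisor `p` are normal: by `MeetsMaximally.commutator_mem` and
`MeetsMaximally.commutator_normalizer_mem` the Sylow subgroups for the smallest prime `q` are
abelian and central in their normalizers, so Burnside's transfer theorem gives a normal
`q`-complement, to which induction applies. -/
theorem sylow_normal_of_sInf_eq_bot (n : ℕ) : ∀ {G : Type u} [Group G] [Finite G],
    Nat.card G = n → ∀ (F : Set (Subgroup G)), (∀ M ∈ F, MeetsMaximally M) → sInf F = ⊥ →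
    ∀ p : ℕ, p.Prime → (∀ r, r.Prime → r ∣ Nat.card G → r ≤ p) → ∀ P : Sylow p G,
    (P : Subgroup G).Normal := by
  induction n using Nat.strong_induction_on with
  | _ n ih =>
  intro G _ _ hn F hF hbot p hp hmax P
  have := Fact.mk hp
  by_cases h1 : Nat.card G = 1
  · have := (Nat.card_eq_one_iff_unique.1 h1).1
    rw [Subsingleton.elim (P : Subgroup G) ⊤]
    infer_instance
  set q := (Nat.card G).minFac with hqdef
  have hq : q.Prime := Nat.minFac_prime h1
  have := Fact.mk hq
  have hqmin : ∀ r, r.Prime → r ∣ Nat.card G → q ≤ r :=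
    fun r hr hd => Nat.minFac_le_of_dvd hr.two_le hd
  let Q : Sylow q G := default
  have hmem : ∀ {g : G}, (∀ M ∈ F, g ∈ M) → g = 1 := fun {g} h => by
    rw [← Subgroup.mem_bot, ← hbot]; exact Subgroup.mem_sInf.2 h
  have hcomm : ∀ x ∈ Q, ∀ y ∈ Q, x * y = y * x := fun x hx y hy =>
    mul_inv_eq_iff_eq_mul.1 (mul_inv_eq_one.1
      (hmem fun M hM => (hF M hM).commutator_mem Q.isPGroup' hx hy))
  have hNC : Subgroup.normalizer ((Q : Subgroup G) : Set G) ≤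
      Subgroup.centralizer ((Q : Subgroup G) : Set G) := by
    refine fun g hg => Subgroup.mem_centralizer_iff.2 fun x hx => ?_
    exact (mul_inv_eq_iff_eq_mul.1 (mul_inv_eq_one.1 (hmem fun M hM =>
      (hF M hM).commutator_normalizer_mem hqmin Q.isPGroup' hcomm hg hx))).symm
  set K := (MonoidHom.transferSylow Q hNC).ker with hK
  have hKQ : Subgroup.IsComplement' K Q := MonoidHom.ker_transferSylow_isComplement' Q hNC
  by_cases hpq : p = q
  · have hG : IsPGroup p G := by
      refine IsPGroup.of_card (n := (Nat.card G).primeFactorsList.length) ?_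
      refine Nat.eq_prime_pow_of_unique_prime_dvd Nat.card_pos.ne' fun {r} hr hd => ?_
      exact le_antisymm (hmax r hr hd) (hpq ▸ hqmin r hr hd)
    have : (P : Subgroup G) = ⊤ :=
      (P.is_maximal' (hG.to_subgroup ⊤) le_top).symm
    rw [this]; infer_instance
  · have hPK : (P : Subgroup G) ≤ K := by
      intro x hx
      rw [hK, MonoidHom.mem_ker]
      by_contra hne
      obtain ⟨k, hk⟩ := P.isPGroup' ⟨x, hx⟩
      have hk' : x ^ p ^ k = 1 := congrArg Subtype.val hk
      have h2 : q ∣ p ^ k := (Q.isPGroup'.dvd_orderOf hne).trans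
        ((orderOf_map_dvd _ x).trans (orderOf_dvd_of_pow_eq_one hk'))
      exact hpq ((Nat.prime_dvd_prime_iff_eq hq hp).1 (hq.dvd_of_dvd_pow h2)).symm
    have hcardK : Nat.card K < n := by
      have h3 := hKQ.card_mul_card
      have h4 : 1 < Nat.card Q := by
        have := Q.dvd_card_of_dvd_card (Nat.minFac_dvd (Nat.card G))
        exact hq.one_lt.trans_le (Nat.le_of_dvd Nat.card_pos this)
      rw [← hn, ← h3]
      exact lt_mul_of_one_lt_right Nat.card_pos h4
    have hnorm := ih _ hcardK (G := K) rfl ((fun M => M.subgroupOf K) '' F)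
      (by rintro _ ⟨M, hM, rfl⟩; exact (hF M hM).subgroupOf K)
      (by
        refine (Subgroup.eq_bot_iff_forall _).2 fun g hg => Subtype.ext (hmem fun M hM => ?_)
        exact Subgroup.mem_sInf.1 hg _ ⟨M, hM, rfl⟩) p hp
      (fun r hr hd => hmax r hr (hd.trans (Subgroup.card_subgroup_dvd_card K))) (P.subtype hPK)
    have hchar := Sylow.characteristic_of_normal (P.subtype hPK) hnorm
    have := ConjAct.normal_of_characteristic_of_normal (H := K) (K := (P.subtype hPK : Subgroup K))
    rwa [Sylow.coe_subtype, Subgroup.map_subgroupOf_eq_of_le hPK] at this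

/-- If `p` is the largest prime divisor of `|G|`, then a modular maximal subgroup `M` with trivial
core has no nontrivial `p`-subgroups: the Sylow `p`-subgroup `P` of `G` is normal and abelian, so
`M ⊓ P` is normal in `M ⊔ P`. -/
theorem IsModularSubgroup.eq_bot_of_normalCore_eq_bot [Finite G] {M : Subgroup G}
    (hM : IsModularSubgroup M) (hc : IsCoatom M) (hcore : M.normalCore = ⊥) {p : ℕ} (hp : p.Prime)
    (hmax : ∀ r, r.Prime → r ∣ Nat.card G → r ≤ p) {X : Subgroup G} (hX : IsPGroup p X)
    (hXM : X ≤ M) : X = ⊥ := by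
  have := Fact.mk hp
  let F : Set (Subgroup G) := Set.range fun g : G => MulAut.conj g • M
  have hF : ∀ N ∈ F, MeetsMaximally N := by
    rintro _ ⟨g, rfl⟩; exact (hM.meetsMaximally hc).smul g
  have hbot : sInf F = ⊥ := by
    rw [← hcore, Subgroup.normalCore_eq_iInf_map_conj]; rfl
  obtain ⟨P, hXP⟩ := hX.exists_le_sylow
  have hPn := sylow_normal_of_sInf_eq_bot _ rfl F hF hbot p hp hmax P
  have hcomm : ∀ x ∈ P, ∀ y ∈ P, x * y = y * x := fun x hx y hy =>
    mul_inv_eq_iff_eq_mul.1 (mul_inv_eq_one.1 (by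
      rw [← Subgroup.mem_bot, ← hbot]
      exact Subgroup.mem_sInf.2 fun M hM => (hF M hM).commutator_mem P.isPGroup' hx hy))
  by_cases hPM : (P : Subgroup G) ≤ M
  · rw [← le_bot_iff, ← hcore]
    exact hXP.trans (Subgroup.normal_le_normalCore.2 hPM)
  · have hsup : M ⊔ P = ⊤ := by
      rcases hc.le_iff.1 (le_sup_left : M ≤ M ⊔ P) with h | h
      · exact h
      · exact absurd (sup_eq_left.1 h) hPM
    have hle := sup_le_normalizer_inf M hcomm
    rw [Subgroup.normalizer_eq_top, inf_top_eq, hsup, top_le_iff] at hle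
    have hn : (M ⊓ P : Subgroup G).Normal := Subgroup.normalizer_eq_top_iff.1 hle
    rw [← le_bot_iff, ← hcore]
    exact (le_inf hXM hXP).trans (Subgroup.normal_le_normalCore.2 inf_le_left)

end

section

variable {G : Type u} [Group G]

theorem IsModularSubgroup.map {G' : Type u} [Group G'] {M : Subgroup G} (hM : IsModularSubgroup M)
    {f : G →* G'} (hf : Function.Surjective f) : IsModularSubgroup (M.map f) := by
  rw [isModularSubgroup_iff_modularIn_top] at *
  simpa [Subgroup.map_top_of_surjective f hf] using hM.map f

theorem IsCoatom.map_of_ker_le {G' : Type*} [Group G'] {M : Subgroup G} (hM : IsCoatom M)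
    {f : G →* G'} (hf : Function.Surjective f) (hk : f.ker ≤ M) : IsCoatom (M.map f) := by
  have e : (M.map f).comap f = M := by rw [Subgroup.comap_map_eq, sup_eq_left.2 hk]
  refine ⟨fun h => hM.1 (by rw [← e, h, Subgroup.comap_top]), fun Y hY => ?_⟩
  have : M < Y.comap f := by
    conv_lhs => rw [← e]
    exact (Subgroup.comap_lt_comap_of_surjective hf).2 hY
  rw [← Subgroup.map_comap_eq_self_of_surjective hf Y, hM.2 _ this,
    Subgroup.map_top_of_surjective f hf]

/-- If `p` is the largest prime divisor of `|G|`, then the core of a modular maximal subgroup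
contains all of its `p`-subgroups. -/
theorem IsModularSubgroup.le_normalCore [Finite G] {M : Subgroup G} (hM : IsModularSubgroup M)
    (hc : IsCoatom M) {p : ℕ} (hp : p.Prime) (hmax : ∀ r, r.Prime → r ∣ Nat.card G → r ≤ p)
    {X : Subgroup G} (hX : IsPGroup p X) (hXM : X ≤ M) : X ≤ M.normalCore := by
  let f := QuotientGroup.mk' M.normalCore
  have hf : Function.Surjective f := QuotientGroup.mk'_surjective _
  have hk : f.ker = M.normalCore := QuotientGroup.ker_mk' _
  have hkM : f.ker ≤ M := hk.le.trans M.normalCore_le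
  have hcore : (M.map f).normalCore = ⊥ := by
    have h1 : ((M.map f).normalCore).comap f ≤ M.normalCore := by
      refine Subgroup.normal_le_normalCore.2 ?_
      exact (Subgroup.comap_mono (Subgroup.normalCore_le _)).trans
        (by rw [Subgroup.comap_map_eq, sup_eq_left.2 hkM])
    rw [← Subgroup.map_comap_eq_self_of_surjective hf (M.map f).normalCore, Subgroup.map_eq_bot_iff,
      hk]
    exact h1
  have := (hM.map hf).eq_bot_of_normalCore_eq_bot (hc.map_of_ker_le hf hkM) hcore hp
    (fun r hr hd => hmax r hr (hd.trans (Subgroup.card_quotient_dvd_card _)))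
    (hX.map f) (Subgroup.map_mono hXM)
  rwa [Subgroup.map_eq_bot_iff, hk] at this

/-! ### Maximal modular subgroups -/

theorem Subgroup.mem_of_zpow_mem_of_isCoprime {H : Subgroup G} {x : G} {a b : ℤ}
    (hab : IsCoprime a b) (ha : x ^ a ∈ H) (hb : x ^ b ∈ H) : x ∈ H := by
  obtain ⟨u, v, h⟩ := hab
  have : x = (x ^ a) ^ u * (x ^ b) ^ v := by
    rw [← zpow_mul, ← zpow_mul, ← zpow_add, mul_comm a, mul_comm b, h, zpow_one]
  rw [this]
  exact H.mul_mem (H.zpow_mem ha _) (H.zpow_mem hb _)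

theorem Subgroup.mem_of_pow_mem_of_coprime {H : Subgroup G} {x : G} {a b : ℕ}
    (hab : Nat.Coprime a b) (ha : x ^ a ∈ H) (hb : x ^ b ∈ H) : x ∈ H :=
  H.mem_of_zpow_mem_of_isCoprime (Nat.isCoprime_iff_coprime.2 hab)
    (by rwa [zpow_natCast]) (by rwa [zpow_natCast])

theorem Subgroup.not_dvd_index_of_forall_mem [Finite G] {H : Subgroup G} {p : ℕ} (hp : p.Prime)
    (h : ∀ t : G, ∀ k, t ^ p ^ k = 1 → t ∈ H) : ¬ p ∣ H.index := by
  have := Fact.mk hp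
  let P : Sylow p G := default
  have hPH : (P : Subgroup G) ≤ H := fun t ht => by
    obtain ⟨k, hk⟩ := P.isPGroup' ⟨t, ht⟩
    exact h t k (congrArg Subtype.val hk)
  exact fun hd => P.not_dvd_index (hd.trans (Subgroup.index_dvd_of_le hPH))

theorem Subgroup.exists_pow_prime_pow_eq_one_notMem [Finite G] {H : Subgroup G} (hH : H ≠ ⊤) :
    ∃ p : ℕ, p.Prime ∧ ∃ t : G, (∃ k, t ^ p ^ k = 1) ∧ t ∉ H := by
  have h1 : H.index ≠ 1 := fun h => hH (Subgroup.index_eq_one.1 h)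
  by_contra! hcon
  have hp := Nat.minFac_prime h1
  exact Subgroup.not_dvd_index_of_forall_mem hp
    (fun t k hk => hcon _ hp t ⟨k, hk⟩) (Nat.minFac_dvd _)

/-- Every proper modular subgroup lies in a proper modular subgroup that is normal or maximal.

Let `K` be maximal among the proper modular subgroups and not normal. Since `K` and a conjugate of
`K` generate a modular subgroup, every proper subgroup above `K` lies in the normalizer `N` of `K`.
If `K < N`, then for `t ∉ N` of prime power order the second modular law gives
`N = K ⊔ (⟨t⟩ ⊓ N)`, so `N / K` is an `s`-group and `t` is an `s`-element, for one fixed prime `s`.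
Therefore the core of `K` contains all elements of order prime to `s`, and `N` is normal, hence
modular, against the choice of `K`. -/
theorem IsModularSubgroup.exists_ge_normal_or_isCoatom [Finite G] {M : Subgroup G}
    (hM : IsModularSubgroup M) (hMt : M ≠ ⊤) :
    ∃ K, M ≤ K ∧ K ≠ ⊤ ∧ IsModularSubgroup K ∧ (K.Normal ∨ IsCoatom K) := by
  obtain ⟨K, hMK, hKmax⟩ :=
    (Set.toFinite {K : Subgroup G | IsModularSubgroup K ∧ K ≠ ⊤}).exists_le_maximal ⟨hM, hMt⟩
  obtain ⟨hK, hKt⟩ := hKmax.prop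
  refine ⟨K, hMK, hKt, hK, ?_⟩
  by_contra! hcon
  obtain ⟨hnn, hnc⟩ := hcon
  have hconj : ∀ g : G, K ⊔ MulAut.conj g • K ≠ ⊤ → g ∈ Subgroup.normalizer (K : Set G) := by
    intro g hg
    have h1 : IsModularSubgroup (MulAut.conj g • K) :=
      hK.map (f := (MulAut.conj g).toMonoidHom) (MulAut.conj g).surjective
    have h2 : MulAut.conj g • K ≤ K :=
      le_sup_right.trans (hKmax.le_of_ge ⟨IsModularElement.sup hK h1, hg⟩ le_sup_left)
    exact Subgroup.mem_normalizer_fintype (fun n hn => h2 ⟨n, hn, rfl⟩)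
  set N := Subgroup.normalizer (K : Set G) with hNdef
  have hKN : K ≤ N := Subgroup.le_normalizer
  have hT : ∀ T, K ≤ T → T ≠ ⊤ → T ≤ N := by
    intro T hKT hTt z hz
    refine hconj z fun h => hTt (top_le_iff.1 (h ▸ sup_le hKT ?_))
    rintro _ ⟨k, hk, rfl⟩
    exact T.mul_mem (T.mul_mem hz (hKT hk)) (T.inv_mem hz)
  have hNt : N ≠ ⊤ := fun h => hnn (Subgroup.normalizer_eq_top_iff.1 h)
  have hNK : ¬ N ≤ K := fun h => hnc ⟨hKt, fun T hT' => by
    by_contra hTt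
    exact hT'.not_ge ((hT T hT'.le hTt).trans h)⟩
  have hsup : ∀ t ∉ N, K ⊔ (Subgroup.zpowers t ⊓ N) = N := by
    intro t ht
    have : K ⊔ Subgroup.zpowers t = ⊤ := by
      by_contra h
      exact ht (hT _ le_sup_left h (le_sup_right (a := K) (Subgroup.mem_zpowers t)))
    rw [hK.2 _ _ hKN, this, top_inf_eq]
  obtain ⟨s, hs, y, ⟨k, hyk⟩, hyN⟩ := Subgroup.exists_pow_prime_pow_eq_one_notMem hNt
  have hpow : ∀ n ∈ N, n ^ s ^ k ∈ K := by
    intro n hn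
    have hn' : n ∈ (Subgroup.zpowers y ⊓ N) ⊔ K := by rw [sup_comm, hsup y hyN]; exact hn
    rw [← SetLike.mem_coe, Subgroup.coe_mul_of_left_le_normalizer_right _ _ inf_le_right] at hn'
    obtain ⟨v, ⟨hv, hvN⟩, w, hw, rfl⟩ := hn'
    obtain ⟨i, rfl⟩ := hv
    have : (K.subgroupOf N).Normal := Subgroup.normal_in_normalizer
    have h1 : ((⟨y ^ i, hvN⟩ * ⟨w, hKN hw⟩ : N) : N ⧸ K.subgroupOf N) ^ s ^ k = 1 := by
      have h2 : ((⟨w, hKN hw⟩ : N) : N ⧸ K.subgroupOf N) = 1 := (QuotientGroup.eq_one_iff _).2 hw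
      rw [QuotientGroup.mk_mul, h2, mul_one, ← QuotientGroup.mk_pow]
      have h3 : (⟨y ^ i, hvN⟩ : N) ^ s ^ k = 1 := by
        refine Subtype.ext ?_
        change (y ^ i) ^ s ^ k = 1
        rw [← zpow_natCast, ← zpow_mul, mul_comm, zpow_mul, zpow_natCast, hyk, one_zpow]
      rw [h3]; rfl
    rw [← QuotientGroup.mk_pow] at h1
    exact (QuotientGroup.eq_one_iff (N := K.subgroupOf N)
      ((⟨y ^ i, hvN⟩ * ⟨w, hKN hw⟩ : N) ^ s ^ k)).1 h1
  have hcop : ∀ r : ℕ, r.Prime → r ≠ s → ∀ j, Nat.Coprime (r ^ j) (s ^ k) := fun r hr hrs j =>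
    Nat.Coprime.pow _ _ ((Nat.coprime_primes hr hs).2 hrs)
  have hmemK : ∀ r : ℕ, r.Prime → r ≠ s → ∀ t : G, ∀ j, t ^ r ^ j = 1 → t ∈ K := by
    intro r hr hrs t j hj
    have htN : t ∈ N := by
      by_contra ht
      refine hNK ((hsup t ht).symm.le.trans (sup_le le_rfl ?_))
      rintro w ⟨⟨i, rfl⟩, hw⟩
      refine Subgroup.mem_of_pow_mem_of_coprime (hcop r hr hrs j) ?_ (hpow _ hw)
      change (t ^ i) ^ r ^ j ∈ K
      rw [← zpow_natCast, ← zpow_mul, mul_comm, zpow_mul, zpow_natCast, hj, one_zpow]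
      exact K.one_mem
    exact Subgroup.mem_of_pow_mem_of_coprime (hcop r hr hrs j) (hj ▸ K.one_mem) (hpow t htN)
  have hQ : IsPGroup s (G ⧸ K.normalCore) := by
    refine IsPGroup.of_card (n := (Nat.card (G ⧸ K.normalCore)).primeFactorsList.length)
      (Nat.eq_prime_pow_of_unique_prime_dvd Nat.card_pos.ne' fun {r} hr hd => ?_)
    by_contra hrs
    refine Subgroup.not_dvd_index_of_forall_mem hr (fun t j hj g => ?_) hd
    refine hmemK r hr hrs _ j ?_
    rw [conj_pow, hj, mul_one, mul_inv_cancel]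
  have hNc : IsCoatom N := ⟨hNt, fun T hNT => by
    by_contra hTt
    exact hNT.not_ge (hT T (hKN.trans hNT.le) hTt)⟩
  have hker : (QuotientGroup.mk' K.normalCore).ker ≤ N := by
    rw [QuotientGroup.ker_mk']; exact K.normalCore_le.trans hKN
  have := Fact.mk hs
  have := hQ.isNilpotent
  have hn := Subgroup.NormalizerCondition.normal_of_coatom _
    Group.normalizerCondition_of_isNilpotent
    (hNc.map_of_ker_le (QuotientGroup.mk'_surjective K.normalCore) hker)
  have hNn : N.Normal := by
    have := hn.comap (QuotientGroup.mk' K.normalCore)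
    rwa [Subgroup.comap_map_eq, sup_eq_left.2 hker] at this
  exact hNK (hKmax.le_of_ge
    ⟨isModularSubgroup_iff_modularIn_top.2 ModularIn.of_normal, hNt⟩ hKN)

/-! ### Submodular subgroups and the largest prime divisor -/

theorem Subgroup.le_normalizer_map_subtype {K : Subgroup G} {R : Subgroup K} (hR : R.Normal) :
    K ≤ Subgroup.normalizer ((R.map K.subtype : Subgroup G) : Set G) := by
  refine Subgroup.le_normalizer_iff.2 ?_
  rintro k hk _ ⟨r, hr, rfl⟩
  exact ⟨_, hR.conj_mem r hr ⟨k, hk⟩, rfl⟩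

/-- A normal `p`-subgroup `R` of a normal subgroup `N` lies in the largest normal `p`-subgroup of
`N`, which is normal in `G`. -/
theorem exists_normal_isPGroup_ge {N R : Subgroup G} [N.Normal] {p : ℕ} (hRN : R ≤ N)
    (hNR : N ≤ Subgroup.normalizer (R : Set G)) (hR : IsPGroup p R) :
    ∃ R' : Subgroup G, R'.Normal ∧ IsPGroup p R' ∧ R ≤ R' := by
  let S : Subgroup N := sSup {T : Subgroup N | T.Normal ∧ IsPGroup p T}
  have hS : IsPGroup p S := Sylow.sSup_of_normal _ (fun H hH => hH.2) (fun H hH => hH.1)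
  have hchar : S.Characteristic := by
    refine Subgroup.characteristic_iff_le_comap.2 fun φ => sSup_le fun T hT => ?_
    rw [← Subgroup.map_le_iff_le_comap]
    exact le_sSup ⟨hT.1.map φ.toMonoidHom φ.surjective, hT.2.map _⟩
  refine ⟨S.map N.subtype, ConjAct.normal_of_characteristic_of_normal, hS.map _, ?_⟩
  rw [← Subgroup.map_subgroupOf_eq_of_le hRN]
  exact Subgroup.map_mono (le_sSup ⟨Subgroup.normal_subgroupOf_of_le_normalizer hNR,
    hR.comap_subtype⟩)

/-- Let `p` be the largest prime divisor of `|G|` and `H` modular in `G`. Then normal `p`-subgroups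
of `H` lie in normal `p`-subgroups of `G`: if `K` is a normal or maximal modular subgroup above `H`,
the `p`-subgroup of `K` obtained by induction lies in the core of `K`. -/
theorem IsModularSubgroup.exists_normal_isPGroup_ge (n : ℕ) : ∀ {G : Type u} [Group G] [Finite G],
    Nat.card G = n → ∀ {H R : Subgroup G}, IsModularSubgroup H → ∀ {p : ℕ}, p.Prime →
    (∀ r, r.Prime → r ∣ Nat.card G → r ≤ p) → R ≤ H → H ≤ Subgroup.normalizer (R : Set G) →
    IsPGroup p R → ∃ R' : Subgroup G, R'.Normal ∧ IsPGroup p R' ∧ R ≤ R' := by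
  induction n using Nat.strong_induction_on with
  | _ n ih =>
  intro G _ _ hn H R hH p hp hmax hRH hHR hR
  by_cases hHt : H = ⊤
  · exact ⟨R, Subgroup.normalizer_eq_top_iff.1 (top_le_iff.1 (hHt ▸ hHR)), hR, le_rfl⟩
  obtain ⟨K, hHK, hKt, hK, hK'⟩ := hH.exists_ge_normal_or_isCoatom hHt
  have hcard : Nat.card K < n := by
    rw [← hn]
    exact lt_of_le_of_ne (Subgroup.card_le_card_group K)
      (fun h => hKt (Subgroup.eq_top_of_card_eq K h))
  have hHK' : IsModularSubgroup (H.subgroupOf K) := by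
    rw [isModularSubgroup_iff_modularIn_top] at hH ⊢
    exact hH.comap K.subtype
  obtain ⟨R₁, hn₁, hp₁, hle₁⟩ := ih _ hcard rfl hHK' hp
    (fun r hr hd => hmax r hr (hd.trans (Subgroup.card_subgroup_dvd_card K)))
    (R := R.subgroupOf K) (Subgroup.comap_mono hRH)
    (Subgroup.le_normalizer_iff.2 fun h hh k hk => Subgroup.le_normalizer_iff.1 hHR h hh k hk)
    hR.comap_subtype
  have hRR₁ : R ≤ R₁.map K.subtype := by
    rw [← Subgroup.map_subgroupOf_eq_of_le (hRH.trans hHK)]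
    exact Subgroup.map_mono hle₁
  have hcore : R₁.map K.subtype ≤ K.normalCore := by
    rcases hK' with h | h
    · rw [K.normalCore_eq_self]; exact Subgroup.map_subtype_le R₁
    · exact hK.le_normalCore h hp hmax (hp₁.map _) (Subgroup.map_subtype_le R₁)
  obtain ⟨R₂, hn₂, hp₂, hle₂⟩ := _root_.exists_normal_isPGroup_ge hcore
    (K.normalCore_le.trans (Subgroup.le_normalizer_map_subtype hn₁)) (hp₁.map _)
  exact ⟨R₂, hn₂, hp₂, hRR₁.trans hle₂⟩

/-- Submodular `p`-subgroups lie in normal `p`-subgroups when `p` is the largest prime divisor of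
the group order. -/
theorem IsSubmodular.exists_normal_isPGroup_ge [Finite G] {X : Subgroup G} (hX : IsSubmodular X)
    {p : ℕ} (hp : p.Prime) (hmax : ∀ r, r.Prime → r ∣ Nat.card G → r ≤ p) (hXp : IsPGroup p X) :
    ∃ R : Subgroup G, R.Normal ∧ IsPGroup p R ∧ X ≤ R := by
  have key : ∀ K : Subgroup G, SubmodularIn X K → ∃ R ≤ K, K ≤ Subgroup.normalizer (R : Set G) ∧
      IsPGroup p R ∧ X ≤ R := by
    intro K hK
    induction hK with
    | refl => exact ⟨X, le_rfl, Subgroup.le_normalizer, hXp, le_rfl⟩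
    | @tail H K _ hHK ih =>
      obtain ⟨R, hRH, hHR, hRp, hXR⟩ := ih
      have hRK := hRH.trans hHK.1
      obtain ⟨R', hn, hp', hle⟩ := IsModularSubgroup.exists_normal_isPGroup_ge _ (G := K) rfl
        ((isModularBelow_iff_subgroupOf hHK.1).1 hHK.2) hp
        (fun r hr hd => hmax r hr (hd.trans (Subgroup.card_subgroup_dvd_card K)))
        (R := R.subgroupOf K) (Subgroup.comap_mono hRH) 
        (Subgroup.le_normalizer_iff.2 fun h hh k hk => Subgroup.le_normalizer_iff.1 hHR h hh k hk)
        hRp.comap_subtype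
      refine ⟨R'.map K.subtype, Subgroup.map_subtype_le R', Subgroup.le_normalizer_map_subtype hn,
        hp'.map _, ?_⟩
      · rw [← Subgroup.map_subgroupOf_eq_of_le (hXR.trans hRK)]
        exact Subgroup.map_mono ((Subgroup.comap_mono hXR).trans hle)
  obtain ⟨R, _, hn, hp', hle⟩ := key ⊤ (isSubmodular_iff_submodularIn_top.1 hX)
  exact ⟨R, Subgroup.normalizer_eq_top_iff.1 (top_le_iff.1 hn), hp', hle⟩

end

/-! ### Action of a submodular `q`-subgroup on a normal `p`-subgroup -/

section

variable {G : Type u} [Group G]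

/-- Automorphisms mapping `x` to powers of `x` commute on `x`. -/
theorem commute_commutator_of_conj_mem_zpowers {a b x : G}
    (ha : a⁻¹ * x * a ∈ Subgroup.zpowers x) (hb : b⁻¹ * x * b ∈ Subgroup.zpowers x) :
    Commute (a * b * a⁻¹ * b⁻¹) x := by
  obtain ⟨i, hi⟩ := ha
  obtain ⟨j, hj⟩ := hb
  replace hi : x ^ i = a⁻¹ * x * a := hi
  replace hj : x ^ j = b⁻¹ * x * b := hj
  have e1 : (a * b)⁻¹ * x * (a * b) = x ^ (j * i) := by
    rw [zpow_mul, hj]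
    have := conj_zpow (i := i) (a := b⁻¹) (b := x)
    rw [inv_inv] at this
    rw [this, hi]; group
  have e2 : (b * a)⁻¹ * x * (b * a) = x ^ (j * i) := by
    rw [mul_comm j, zpow_mul, hi]
    have := conj_zpow (i := j) (a := a⁻¹) (b := x)
    rw [inv_inv] at this
    rw [this, hj]; group
  have e3 := e1.trans e2.symm
  change a * b * a⁻¹ * b⁻¹ * x = x * (a * b * a⁻¹ * b⁻¹)
  calc a * b * a⁻¹ * b⁻¹ * x = (a * b) * ((b * a)⁻¹ * x * (b * a)) * (b * a)⁻¹ := by group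
    _ = (a * b) * ((a * b)⁻¹ * x * (a * b)) * (b * a)⁻¹ := by rw [e3]
    _ = x * (a * b * a⁻¹ * b⁻¹) := by group

/-- Let a modular subgroup `M` normalize a group `⟨x⟩` of order dividing the prime `p`, with
`M ⊓ ⟨x⟩ = ⊥`. If `g ∈ M` is a `q`-element, then `g ^ q` centralizes `x`. Otherwise the first
modular law fails for the conjugates of `⟨g ^ q⟩` and `⟨g⟩` by `x`. -/
theorem IsModularSubgroup.commute_pow {M : Subgroup G} (hM : IsModularSubgroup M) {p q : ℕ}
    (hp : p.Prime) (hq : q.Prime) {x g : G} (hx : x ^ p = 1)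
    (hMx : M ≤ Subgroup.normalizer ((Subgroup.zpowers x : Subgroup G) : Set G))
    (hinf : M ⊓ Subgroup.zpowers x = ⊥) (hg : g ∈ M) {k : ℕ} (hgk : g ^ q ^ k = 1) :
    Commute (g ^ q) x := by
  by_contra hcon
  have hgk' : g ^ ((q ^ k : ℕ) : ℤ) = 1 := by rw [zpow_natCast, hgk]
  have hcomm : ∀ m ∈ M, x * m * x⁻¹ * m⁻¹ ∈ Subgroup.zpowers x := by
    intro m hm
    have := Subgroup.le_normalizer_iff.1 hMx m hm _ (Subgroup.inv_mem _ (Subgroup.mem_zpowers x))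
    have := Subgroup.mul_mem _ (Subgroup.mem_zpowers x) this
    rwa [← mul_assoc, ← mul_assoc] at this
  have hconj : ∀ (a : G) (i : ℤ), (x * a * x⁻¹) ^ i = x * a ^ i * x⁻¹ := fun a i => conj_zpow
  set Y := Subgroup.zpowers (x * g ^ q * x⁻¹)
  set Z := Subgroup.zpowers (x * g * x⁻¹)
  have hYZ : Y ≤ Z := by
    rw [Subgroup.zpowers_le]
    exact ⟨q, by simp only; rw [hconj, zpow_natCast]⟩
  have hMZ : M ⊓ Z ≤ Y := by
    rintro _ ⟨hm, i, rfl⟩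
    simp only [hconj] at hm ⊢
    have h1 : x * g ^ i * x⁻¹ * (g ^ i)⁻¹ = 1 := by
      rw [← Subgroup.mem_bot, ← hinf]
      exact ⟨M.mul_mem hm (M.inv_mem (M.zpow_mem hg i)), hcomm _ (M.zpow_mem hg i)⟩
    by_cases hqi : (q : ℤ) ∣ i
    · obtain ⟨j, rfl⟩ := hqi
      refine ⟨j, ?_⟩
      simp only [hconj]
      rw [zpow_mul, zpow_natCast]
    · exfalso
      have hS : ∀ a : G, a ∈ Subgroup.centralizer {x} ↔ Commute a x := fun a => by
        rw [Subgroup.mem_centralizer_singleton_iff]; exact ⟨fun h => h, fun h => h⟩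
      have h2 : g ∈ Subgroup.centralizer {x} := by
        refine Subgroup.mem_of_zpow_mem_of_isCoprime (a := i) (b := ((q ^ k : ℕ) : ℤ)) ?_ ?_ ?_
        · push_cast
          exact (IsCoprime.pow_left ((Nat.prime_iff_prime_int.1 hq).coprime_iff_not_dvd.2 hqi)).symm
        · rw [hS]
          exact (mul_inv_eq_iff_eq_mul.1 (mul_inv_eq_one.1 h1)).symm
        · rw [hgk']; exact Subgroup.one_mem _
      exact hcon (((hS g).1 h2).pow_left q)
  have hxH : x ∈ Y ⊔ M := by
    have hw := hcomm _ (M.pow_mem hg q)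
    obtain ⟨i, hi⟩ := hw
    replace hi : x ^ i = x * g ^ q * x⁻¹ * (g ^ q)⁻¹ := hi
    have hxi : x ^ i ∈ Y ⊔ M := by
      rw [hi]
      exact Subgroup.mul_mem_sup (Subgroup.mem_zpowers _) (M.inv_mem (M.pow_mem hg q))
    refine Subgroup.mem_of_zpow_mem_of_isCoprime (a := (p : ℤ)) (b := i) ?_ ?_ hxi
    · refine (Nat.prime_iff_prime_int.1 hp).coprime_iff_not_dvd.2 ?_
      rintro ⟨j, rfl⟩
      rw [zpow_mul, zpow_natCast, hx, one_zpow] at hi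
      exact hcon (mul_inv_eq_iff_eq_mul.1 (mul_inv_eq_one.1 hi.symm)).symm
    · rw [zpow_natCast, hx]; exact Subgroup.one_mem _
  have hZ : Z ≤ Y ⊔ M := by
    rw [Subgroup.zpowers_le]
    have hgH : g ∈ Y ⊔ M := (le_sup_right : M ≤ Y ⊔ M) hg
    exact Subgroup.mul_mem _ (Subgroup.mul_mem _ hxH hgH) (Subgroup.inv_mem _ hxH)
  have hlaw := hM.1 Y Z hYZ
  rw [sup_eq_left.2 hMZ, inf_eq_right.2 hZ] at hlaw
  have hgY : x * g * x⁻¹ ∈ Y := hlaw ▸ Subgroup.mem_zpowers _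
  obtain ⟨j, hj⟩ := hgY
  simp only [hconj] at hj
  have hj' : g ^ ((q : ℤ) * j) = g := by
    rw [zpow_mul, zpow_natCast]
    exact mul_left_cancel (mul_right_cancel hj)
  have hg1 : g ∈ (⊥ : Subgroup G) := by
    refine Subgroup.mem_of_zpow_mem_of_isCoprime (a := 1 - (q : ℤ) * j) (b := ((q ^ k : ℕ) : ℤ)) ?_
      ?_ ?_
    · push_cast
      refine IsCoprime.pow_right ⟨1, j, by ring⟩
    · rw [zpow_sub, hj', zpow_one, mul_inv_cancel]; exact Subgroup.one_mem _
    · rw [hgk']; exact Subgroup.one_mem _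
  rw [Subgroup.mem_bot] at hg1
  rw [hg1, one_pow] at hcon
  exact hcon (Commute.one_left x)

/-- A modular subgroup normalizes every subgroup `X` with `M ⊓ P ≤ X ≤ P`, where `P` is normal:
the first modular law gives `X = (X ⊔ M) ⊓ P`. -/
theorem IsModularSubgroup.le_normalizer_of_inf_le {M P X : Subgroup G} (hM : IsModularSubgroup M)
    [hP : P.Normal] (hX : M ⊓ P ≤ X) (hXP : X ≤ P) : M ≤ Subgroup.normalizer (X : Set G) := by
  have h : X = (X ⊔ M) ⊓ P := by rw [← hM.1 X P hXP, sup_eq_left.2 hX]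
  refine Subgroup.le_normalizer_iff.2 fun m hm x hx => ?_
  have hm' : m ∈ X ⊔ M := (le_sup_right : M ≤ X ⊔ M) hm
  have hx' : x ∈ X ⊔ M := (le_sup_left : X ≤ X ⊔ M) hx
  rw [h]
  exact ⟨Subgroup.mul_mem _ (Subgroup.mul_mem _ hm' hx') (Subgroup.inv_mem _ hm'),
    hP.conj_mem x (hXP hx) m⟩

/-- A `q`-element `e` centralizes a `p`-subgroup `P`, `p ≠ q`, as soon as it acts trivially on
`⟨C, x⟩ / C` for all `x ∈ P` normalizing `C = C_P(e)` with `x ^ p ∈ C`. -/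
theorem forall_commute_of_forall_commutator_mem [Finite G] {P : Subgroup G} {p q : ℕ} (hp : p.Prime)
    (hq : q.Prime) (hpq : p ≠ q) (hP : IsPGroup p P) {e : G} {k : ℕ} (he : e ^ q ^ k = 1)
    (h : ∀ x ∈ P, x ∈ Subgroup.normalizer ((P ⊓ Subgroup.centralizer {e} : Subgroup G) : Set G) →
      x ^ p ∈ P ⊓ Subgroup.centralizer {e} →
      e * x * e⁻¹ * x⁻¹ ∈ P ⊓ Subgroup.centralizer {e}) :
    ∀ x ∈ P, Commute e x := by
  set C := P ⊓ Subgroup.centralizer {e} with hC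
  have := Fact.mk hp
  have hCm : ∀ a, a ∈ C ↔ a ∈ P ∧ Commute e a := fun a => by
    rw [hC, Subgroup.mem_inf, Subgroup.mem_centralizer_singleton_iff]
    exact and_congr_right fun _ => ⟨fun h => h.symm, fun h => h.symm⟩
  by_contra hcon
  have hCP : C.subgroupOf P < ⊤ := by
    refine lt_top_iff_ne_top.2 fun ht => hcon fun x hx => ?_
    exact ((hCm x).1 (Subgroup.subgroupOf_eq_top.1 ht hx)).2
  have := hP.isNilpotent
  obtain ⟨⟨y, hyP⟩, hyN, hyC⟩ := SetLike.exists_of_lt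
    (Group.normalizerCondition_of_isNilpotent _ hCP)
  have hyN' : y ∈ Subgroup.normalizer (C : Set G) := by
    refine Subgroup.mem_normalizer_fintype fun n hn => ?_
    exact (Subgroup.mem_normalizer_iff.1 hyN ⟨n, ((hCm n).1 hn).1⟩).1 hn
  have hyC' : y ∉ C := hyC
  obtain ⟨j, hj⟩ := hP ⟨y, hyP⟩
  have hj' : y ^ p ^ j ∈ C := by
    have : y ^ p ^ j = 1 := congrArg Subtype.val hj
    rw [this]; exact C.one_mem
  -- Replace `y` by its last power of the form `y ^ p ^ i` outside `C`.
  obtain ⟨x, hxP, hxN, hxC, hxp⟩ : ∃ x ∈ P, x ∈ Subgroup.normalizer (C : Set G) ∧ x ∉ C ∧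
      x ^ p ∈ C := by
    classical
    have hex : ∃ i, y ^ p ^ i ∈ C := ⟨j, hj'⟩
    have h0 : Nat.find hex ≠ 0 := fun h0 => by
      have := Nat.find_spec hex
      rw [h0, pow_zero, pow_one] at this
      exact hyC' this
    obtain ⟨i, hi⟩ := Nat.exists_eq_succ_of_ne_zero h0
    refine ⟨y ^ p ^ i, P.pow_mem hyP _, Subgroup.pow_mem _ hyN' _,
      Nat.find_min hex (by omega), ?_⟩
    have := Nat.find_spec hex
    rwa [hi, pow_succ, pow_mul] at this
  have hc := h x hxP hxN hxp
  set c := e * x * e⁻¹ * x⁻¹ with hcdef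
  obtain ⟨hcP, hce⟩ := (hCm c).1 hc
  have hex : e * x = c * x * e := by rw [hcdef]; group
  have hpow : ∀ n : ℕ, e ^ n * x = c ^ n * x * e ^ n := by
    intro n
    induction n with
    | zero => simp
    | succ n ih =>
      calc e ^ (n + 1) * x = e ^ n * (e * x) := by rw [pow_succ, mul_assoc]
        _ = (e ^ n * c) * x * e := by rw [hex]; simp only [mul_assoc]
        _ = c * (e ^ n * x) * e := by rw [(hce.pow_left n).eq]; simp only [mul_assoc]
        _ = c ^ (n + 1) * x * e ^ (n + 1) := by
          rw [ih, pow_succ' c, pow_succ e]; simp only [mul_assoc]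
  have hcq : c ^ q ^ k = 1 := by
    have := hpow (q ^ k)
    rw [he, one_mul, mul_one] at this
    exact mul_eq_right.1 this.symm
  obtain ⟨i, hi⟩ := hP ⟨c, hcP⟩
  have hci : c ^ p ^ i = 1 := congrArg Subtype.val hi
  have hc1 : c ∈ (⊥ : Subgroup G) :=
    Subgroup.mem_of_pow_mem_of_coprime (Nat.Coprime.pow _ _ ((Nat.coprime_primes hp hq).2 hpq))
      (hci ▸ Subgroup.one_mem _) (hcq ▸ Subgroup.one_mem _)
  rw [Subgroup.mem_bot] at hc1
  rw [hc1, one_mul] at hex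
  exact hxC ((hCm x).2 ⟨hxP, hex⟩)

/-- `e` is the `q`-th power of a `q`-element of `M` or the commutator of two elements of `M`. -/
def IsPowerOrCommutator {G : Type*} [Group G] (q : ℕ) (M : Subgroup G) (e : G) : Prop :=
  (∃ g ∈ M, (∃ k, g ^ q ^ k = 1) ∧ e = g ^ q) ∨ ∃ g ∈ M, ∃ h ∈ M, e = g * h * g⁻¹ * h⁻¹

/-- The inductive step for `IsSubmodular.commute_of_isPowerOrCommutator`. Modulo `C = C_P(e)`, the
subgroup `M` normalizes `⟨x⟩` and meets it trivially, so
`commute_commutator_of_conj_mem_zpowers` and `IsModularSubgroup.commute_pow` apply. -/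
theorem IsModularSubgroup.commute_of_isPowerOrCommutator [Finite G] {M P : Subgroup G}
    (hM : IsModularSubgroup M) [P.Normal] {p q : ℕ} (hp : p.Prime) (hq : q.Prime) (hpq : p ≠ q)
    (hP : IsPGroup p P) {e : G} {k : ℕ} (hek : e ^ q ^ k = 1) (he : IsPowerOrCommutator q M e)
    (hcomm : ∀ x ∈ M ⊓ P, Commute e x) : ∀ x ∈ P, Commute e x := by
  refine forall_commute_of_forall_commutator_mem hp hq hpq hP hek fun x hxP hxN hxp => ?_
  set C := P ⊓ Subgroup.centralizer {e} with hC
  have hMC : M ⊓ P ≤ C := fun y hy =>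
    ⟨hy.2, Subgroup.mem_centralizer_singleton_iff.2 (hcomm y hy).symm⟩
  have hMN : M ≤ Subgroup.normalizer (C : Set G) := hM.le_normalizer_of_inf_le hMC inf_le_left
  have hXP : C ⊔ Subgroup.zpowers x ≤ P := sup_le inf_le_left (Subgroup.zpowers_le.2 hxP)
  have hMX := hM.le_normalizer_of_inf_le (hMC.trans le_sup_left) hXP
  set N := Subgroup.normalizer (C : Set G) with hN
  set C' := C.subgroupOf N with hC'
  have hC'n : C'.Normal := Subgroup.normal_in_normalizer
  let π : N →* N ⧸ C' := QuotientGroup.mk' C'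
  have hπ : ∀ y : N, π y = 1 ↔ (y : G) ∈ C := fun y => QuotientGroup.eq_one_iff y
  let x' : N := ⟨x, hxN⟩
  have hconj : ∀ (m : G) (hm : m ∈ M),
      π ⟨m, hMN hm⟩ * π x' * (π ⟨m, hMN hm⟩)⁻¹ ∈ Subgroup.zpowers (π x') := by
    intro m hm
    have h1 := Subgroup.le_normalizer_iff.1 hMX m hm x
      ((le_sup_right : _ ≤ C ⊔ _) (Subgroup.mem_zpowers x))
    rw [sup_comm, ← SetLike.mem_coe, Subgroup.coe_mul_of_left_le_normalizer_right _ _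
      (Subgroup.zpowers_le.2 hxN)] at h1
    obtain ⟨_, ⟨i, rfl⟩, c, hc, hic⟩ := h1
    refine ⟨i, ?_⟩
    have h2 : (⟨m, hMN hm⟩ * x' * ⟨m, hMN hm⟩⁻¹ : N) =
        x' ^ i * ⟨c, Subgroup.le_normalizer hc⟩ := Subtype.ext hic.symm
    have h3 := congrArg π h2
    rw [map_mul, map_mul, map_mul, map_inv, map_zpow,
      (hπ ⟨c, Subgroup.le_normalizer hc⟩).2 hc, mul_one] at h3
    exact h3.symm
  suffices hs : ∀ heN : e ∈ N, Commute (π ⟨e, heN⟩) (π x') by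
    have heM : e ∈ M := by
      rcases he with ⟨g, hg, _, rfl⟩ | ⟨g, hg, h, hh, rfl⟩
      · exact M.pow_mem hg q
      · exact M.mul_mem (M.mul_mem (M.mul_mem hg hh) (M.inv_mem hg)) (M.inv_mem hh)
    have := (hπ (⟨e, hMN heM⟩ * x' * ⟨e, hMN heM⟩⁻¹ * x'⁻¹)).1 (by
      rw [map_mul, map_mul, map_mul, map_inv, map_inv, (hs (hMN heM)).eq]; group)
    exact this
  intro heN
  rcases he with ⟨g, hg, ⟨j, hgj⟩, rfl⟩ | ⟨g, hg, h, hh, rfl⟩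
  · have hM' : IsModularSubgroup (M.subgroupOf N) := by
      rw [isModularSubgroup_iff_modularIn_top] at hM ⊢
      exact hM.comap N.subtype
    have h1 : Commute ((π ⟨g, hMN hg⟩) ^ q) (π x') := by
      refine (hM'.map (QuotientGroup.mk'_surjective C')).commute_pow hp hq (k := j) ?_ ?_ ?_ ?_ ?_
      · rw [← map_pow]; exact (hπ _).2 hxp
      · rw [Subgroup.le_normalizer_iff]
        rintro _ ⟨⟨m, hmN⟩, hm, rfl⟩ _ ⟨i, rfl⟩
        have := Subgroup.zpow_mem _ (hconj m hm) i
        rwa [conj_zpow] at this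
      · rw [Subgroup.eq_bot_iff_forall]
        rintro _ ⟨⟨⟨m, hmN⟩, hm, rfl⟩, i, hi⟩
        refine (hπ _).2 (hMC ⟨hm, ?_⟩)
        have h2 : π (⟨m, hmN⟩ * (x' ^ i)⁻¹) = 1 := by
          rw [map_mul, map_inv, map_zpow]; exact mul_inv_eq_one.2 hi.symm
        have h3 := ((hπ _).1 h2).1
        exact (P.mul_mem_cancel_right (P.inv_mem (P.zpow_mem hxP i))).1 h3
      · exact ⟨⟨g, hMN hg⟩, hg, rfl⟩
      · rw [← map_pow]
        exact (hπ _).2 (by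
          change g ^ q ^ j ∈ C
          rw [hgj]; exact C.one_mem)
    rw [← map_pow] at h1
    exact h1
  · have key : ∀ (m : G) (hm : m ∈ M),
        (π ⟨m, hMN hm⟩)⁻¹ * π x' * π ⟨m, hMN hm⟩ ∈ Subgroup.zpowers (π x') := fun m hm => by
      have h2 := hconj m⁻¹ (M.inv_mem hm)
      have h3 : π ⟨m⁻¹, hMN (M.inv_mem hm)⟩ = (π ⟨m, hMN hm⟩)⁻¹ := by rw [← map_inv]; rfl
      rwa [h3, inv_inv] at h2
    have h1 := commute_commutator_of_conj_mem_zpowers (key g hg) (key h hh)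
    rw [← map_inv, ← map_inv, ← map_mul, ← map_mul, ← map_mul] at h1
    exact h1

/-- The `q`-th powers and the commutators of a submodular `q`-subgroup centralize every normal
`p`-subgroup, `p ≠ q`. -/
theorem IsSubmodular.commute_of_isPowerOrCommutator [Finite G] {Q P : Subgroup G}
    (hQ : IsSubmodular Q) [hPn : P.Normal] {p q : ℕ} (hp : p.Prime) (hq : q.Prime) (hpq : p ≠ q)
    (hP : IsPGroup p P) (hQq : IsPGroup q Q) {e : G} (he : IsPowerOrCommutator q Q e) :
    ∀ x ∈ P, Commute e x := by
  have := Fact.mk hp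
  have := Fact.mk hq
  have heQ : e ∈ Q := by
    rcases he with ⟨g, hg, _, rfl⟩ | ⟨g, hg, h, hh, rfl⟩
    · exact Q.pow_mem hg q
    · exact Q.mul_mem (Q.mul_mem (Q.mul_mem hg hh) (Q.inv_mem hg)) (Q.inv_mem hh)
  obtain ⟨k, hk⟩ := hQq ⟨e, heQ⟩
  have key : ∀ K : Subgroup G, SubmodularIn Q K → Q ≤ K ∧ ∀ x ∈ K ⊓ P, Commute e x := by
    intro K hK
    induction hK with
    | refl =>
      refine ⟨le_rfl, fun x hx => ?_⟩
      have := (IsPGroup.disjoint_of_ne q p hpq.symm Q P hQq hP).le_bot hx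
      rw [Subgroup.mem_bot.1 this]
      exact Commute.one_right e
    | @tail H K _ hHK ih =>
      obtain ⟨hQH, ih⟩ := ih
      have hQK := hQH.trans hHK.1
      refine ⟨hQK, fun x hx => ?_⟩
      have hPK : (P.subgroupOf K).Normal := hPn.comap K.subtype
      have he' : IsPowerOrCommutator q (H.subgroupOf K) (⟨e, hQK heQ⟩ : K) := by
        rcases he with ⟨g, hg, ⟨j, hj⟩, rfl⟩ | ⟨g, hg, h, hh, rfl⟩
        · exact Or.inl ⟨⟨g, hQK hg⟩, hQH hg, ⟨j, Subtype.ext hj⟩, rfl⟩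
        · exact Or.inr ⟨⟨g, hQK hg⟩, hQH hg, ⟨h, hQK hh⟩, hQH hh, rfl⟩
      have := ((isModularBelow_iff_subgroupOf hHK.1).1 hHK.2).commute_of_isPowerOrCommutator
        hp hq hpq (P := P.subgroupOf K) hP.comap_subtype (k := k)
        (Subtype.ext (congrArg Subtype.val hk : _)) he'
        (fun y hy => Subtype.ext (ih y ⟨hy.1, hy.2⟩).eq) ⟨x, hx.1⟩ hx.2
      exact congrArg Subtype.val this.eq
  exact fun x hx => (key ⊤ (isSubmodular_iff_submodularIn_top.1 hQ)).2 x ⟨Subgroup.mem_top x, hx⟩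

end

/-! ### Behaviour of the hypotheses under epimorphisms -/

section

variable {G : Type u} [Group G]

theorem IsSquarefreeA.of_mulEquiv {G' : Type u} [Group G'] (e : G ≃* G') (h : IsSquarefreeA G) :
    IsSquarefreeA G' := by
  refine ⟨fun p hp P x hx y hy => ?_, by rw [← Monoid.exponent_eq_of_mulEquiv e]; exact h.2⟩
  have := h.1 p hp (P.comapOfInjective e.toMonoidHom e.injective
    (fun z _ => ⟨e.symm z, e.apply_symm_apply z⟩)) (e.symm x)
    (by
      change e (e.symm x) ∈ P; rwa [e.apply_symm_apply]) (e.symm y) (by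
      change e (e.symm y) ∈ P; rwa [e.apply_symm_apply])
  rw [← map_mul, ← map_mul] at this
  exact e.symm.injective this

theorem card_quotient_formationResidual_dvd {G' : Type u} [Group G'] {f : G →* G'}
    (hf : Function.Surjective f) :
    Nat.card (G' ⧸ formationResidual IsSquarefreeA G') ∣
      Nat.card (G ⧸ formationResidual IsSquarefreeA G) := by
  change (formationResidual IsSquarefreeA G').index ∣ (formationResidual IsSquarefreeA G).index
  rw [← Subgroup.index_comap_of_surjective _ hf]
  refine Subgroup.index_dvd_of_le ?_
  rw [← Subgroup.map_le_iff_le_comap]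
  refine le_sInf ?_
  rintro N ⟨hN, hNA⟩
  rw [Subgroup.map_le_iff_le_comap]
  refine sInf_le ⟨hN.comap f, ?_⟩
  refine hNA.of_mulEquiv ((QuotientGroup.quotientMulEquivOfEq ?_).trans
    (QuotientGroup.quotientKerEquivOfSurjective ((QuotientGroup.mk' N).comp f)
      ((QuotientGroup.mk'_surjective N).comp hf))).symm
  rw [← MonoidHom.comap_ker, QuotientGroup.ker_mk']

theorem map_fittingSubgroup_le {G' : Type u} [Group G'] {f : G →* G'}
    (hf : Function.Surjective f) : (fittingSubgroup G).map f ≤ fittingSubgroup G' := by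
  rw [Subgroup.map_le_iff_le_comap]
  refine sSup_le fun N hN => ?_
  rw [← Subgroup.map_le_iff_le_comap]
  have := hN.2
  exact le_sSup ⟨hN.1.map f hf, Group.nilpotent_of_surjective (f.subgroupMap N)
    (f.subgroupMap_surjective N)⟩

/-! ### Indices in factorized groups -/

/-- If `G = AB` and `B ≤ H`, then `A` acts transitively on the cosets of `H`. -/
theorem Subgroup.relIndex_eq_index_of_mul_eq_univ {A B H : Subgroup G}
    (hAB : (A : Set G) * (B : Set G) = Set.univ) (hBH : B ≤ H) : H.relIndex A = H.index := by
  have h1 : H.subgroupOf A = MulAction.stabilizer A ((1 : G) : G ⧸ H) := by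
    ext a
    rw [MulAction.mem_stabilizer_iff, Subgroup.mem_subgroupOf]
    change _ ↔ (((a : G) * 1 : G) : G ⧸ H) = ((1 : G) : G ⧸ H)
    rw [mul_one, eq_comm, QuotientGroup.eq]; simp
  have h2 : MulAction.orbit A ((1 : G) : G ⧸ H) = Set.univ := by
    refine Set.eq_univ_of_forall fun x => ?_
    obtain ⟨g, rfl⟩ := QuotientGroup.mk_surjective x
    obtain ⟨a, ha, b, hb, rfl⟩ := Set.mem_mul.1 (hAB ▸ Set.mem_univ g)
    refine ⟨⟨a, ha⟩, ?_⟩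
    change ((a * 1 : G) : G ⧸ H) = ((a * b : G) : G ⧸ H)
    rw [QuotientGroup.eq]; simpa using hBH hb
  rw [Subgroup.relIndex, h1, MulAction.index_stabilizer, h2, Set.ncard_univ]
  rfl

theorem Subgroup.mul_eq_univ_symm {A B : Subgroup G}
    (hAB : (A : Set G) * (B : Set G) = Set.univ) : (B : Set G) * (A : Set G) = Set.univ := by
  have := congrArg (·⁻¹) hAB
  simpa [mul_inv_rev] using this

/-- If `G = AB`, then `|G : O|` is the product of `|BO : O| = |B : B ⊓ O|` and
`|G : BO| = |A : A ⊓ BO|`. -/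
theorem Subgroup.index_dvd_relIndex_mul_relIndex {A B O : Subgroup G} [O.Normal]
    (hAB : (A : Set G) * (B : Set G) = Set.univ) : O.index ∣ O.relIndex B * O.relIndex A := by
  rw [← Subgroup.relIndex_mul_index (le_sup_right : O ≤ B ⊔ O), Subgroup.relIndex_sup_right,
    ← Subgroup.relIndex_eq_index_of_mul_eq_univ hAB (le_sup_left : B ≤ B ⊔ O)]
  exact mul_dvd_mul_left _ (Subgroup.relIndex_dvd_of_le_left A le_sup_right)

theorem Subgroup.card_mul_relIndex' {H K : Subgroup G} (h : H ≤ K) :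
    Nat.card H * H.relIndex K = Nat.card K := by
  rw [← Subgroup.relIndex_bot_left, ← Subgroup.relIndex_bot_left,
    Subgroup.relIndex_mul_relIndex _ _ _ bot_le h]

theorem Subgroup.relIndex_sup_dvd_card [Finite G] (A O : Subgroup G) [O.Normal] :
    A.relIndex (A ⊔ O) ∣ Nat.card O := by
  have h1 := Subgroup.card_mul_relIndex' (le_sup_left : A ≤ A ⊔ O)
  have h2 := Subgroup.card_mul_relIndex' (le_sup_right : O ≤ A ⊔ O)
  rw [Subgroup.relIndex_sup_right] at h2
  refine Nat.dvd_of_mul_dvd_mul_left (Nat.card_pos (α := A)) ?_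
  rw [h1, ← h2, mul_comm]
  exact mul_dvd_mul_right (Subgroup.relIndex_dvd_card O A) _

/-! ### Groups with a normal Sylow subgroup -/

theorem Subgroup.le_of_isPGroup_of_not_dvd_index [Finite G] {O X : Subgroup G} [O.Normal] {p : ℕ}
    (hp : p.Prime) (hX : IsPGroup p X) (hi : ¬ p ∣ O.index) : X ≤ O := by
  have := Fact.mk hp
  have h : X.map (QuotientGroup.mk' O) = ⊥ := by
    rw [← Subgroup.card_eq_one]
    exact (hX.map (QuotientGroup.mk' O)).card_eq_or_dvd.resolve_right
      fun h => hi (h.trans (Subgroup.card_subgroup_dvd_card _))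
  rwa [Subgroup.map_eq_bot_iff, QuotientGroup.ker_mk'] at h

/-- If a normal Sylow `p`-subgroup `O` does not contain its centralizer, then `G` has a nontrivial
normal subgroup of order prime to `p`: the normal `p`-complement of the centralizer, which exists by
Burnside's transfer theorem and consists of the elements of order prime to `p`. -/
theorem Subgroup.exists_normal_not_dvd_card [Finite G] {O : Subgroup G} [hO : O.Normal] {p : ℕ}
    (hp : p.Prime) (hOp : IsPGroup p O) (hi : ¬ p ∣ O.index)
    (hc : ¬ Subgroup.centralizer (O : Set G) ≤ O) :
    ∃ K : Subgroup G, K.Normal ∧ K ≠ ⊥ ∧ ¬ p ∣ Nat.card K := by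
  have := Fact.mk hp
  set C := Subgroup.centralizer (O : Set G)
  have hSp : IsPGroup p (O.subgroupOf C) := hOp.comap_subtype
  let S : Sylow p C := hSp.toSylow fun h =>
    hi (h.trans (Subgroup.relIndex_dvd_index_of_normal O C))
  have hS : (S : Subgroup C) = O.subgroupOf C := hSp.toSylow_coe _
  have hNC : Subgroup.normalizer ((S : Subgroup C) : Set C) ≤
      Subgroup.centralizer ((S : Subgroup C) : Set C) := by
    refine fun c _ => Subgroup.mem_centralizer_iff.2 fun z hz => ?_
    rw [hS] at hz
    exact Subtype.ext (Subgroup.mem_centralizer_iff.1 c.2 z hz)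
  set K := (MonoidHom.transferSylow S hNC).ker with hK
  have hcompl : Subgroup.IsComplement' K S := MonoidHom.ker_transferSylow_isComplement' S hNC
  have hndvd : ¬ p ∣ Nat.card K := MonoidHom.not_dvd_card_ker_transferSylow S hNC
  have hmem : ∀ x, x ∈ K ↔ ¬ p ∣ orderOf x := by
    intro x
    constructor
    · intro hx hd
      refine hndvd (hd.trans ?_)
      exact Subgroup.orderOf_dvd_natCard K hx
    · intro hx
      rw [hK, MonoidHom.mem_ker]
      by_contra hne
      exact hx ((S.isPGroup'.dvd_orderOf hne).trans (orderOf_map_dvd _ x))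
  have hchar : K.Characteristic := by
    refine Subgroup.characteristic_iff_le_comap.2 fun φ x hx => ?_
    rw [Subgroup.mem_comap, hmem]
    rw [hmem] at hx
    exact fun hd => hx (hd.trans (orderOf_map_dvd _ x))
  have : C.Normal := Subgroup.normal_centralizer
  refine ⟨K.map C.subtype, ConjAct.normal_of_characteristic_of_normal, fun h => ?_, ?_⟩
  · rw [Subgroup.map_eq_bot_iff_of_injective _ C.subtype_injective] at h
    rw [h, Subgroup.isComplement'_bot_left, hS] at hcompl
    exact hc (Subgroup.subgroupOf_eq_top.1 hcompl)
  · rwa [Subgroup.card_map_of_injective C.subtype_injective]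

theorem fittingSubgroup_le_of_forall_eq_bot [Finite G] {O : Subgroup G} [O.Normal] {p : ℕ}
    (hp : p.Prime) (hi : ¬ p ∣ O.index)
    (h : ∀ K : Subgroup G, K.Normal → ¬ p ∣ Nat.card K → K = ⊥) : fittingSubgroup G ≤ O := by
  have := Fact.mk hp
  refine sSup_le ?_
  rintro N ⟨hN, hnil⟩
  have hNp : IsPGroup p N := by
    refine IsPGroup.of_card (n := (Nat.card N).primeFactorsList.length)
      (Nat.eq_prime_pow_of_unique_prime_dvd Nat.card_pos.ne' fun {r} hr hd => ?_)
    by_contra hrp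
    have := Fact.mk hr
    let R : Sylow r N := default
    have hRn : (R : Subgroup N).Normal := R.normal_of_normalizerCondition
      Group.normalizerCondition_of_isNilpotent
    have := Sylow.characteristic_of_normal R hRn
    have hbot := h ((R : Subgroup N).map N.subtype) ConjAct.normal_of_characteristic_of_normal (by
      rw [Subgroup.card_map_of_injective N.subtype_injective]
      obtain ⟨k, hk⟩ := IsPGroup.iff_card.1 R.isPGroup'
      rw [hk]
      exact fun hd => hrp ((Nat.prime_dvd_prime_iff_eq hp hr).1 (hp.dvd_of_dvd_pow hd)).symm)
    rw [Subgroup.map_eq_bot_iff_of_injective _ N.subtype_injective] at hbot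
    exact R.ne_bot_of_dvd_card hd hbot
  exact Subgroup.le_of_isPGroup_of_not_dvd_index hp hNp hi

/-- Let `O` be a normal Sylow `p`-subgroup containing its centralizer. If `A` is submodular and has
submodular Sylow subgroups, then `A / (A ⊓ O)` lies in `𝒜₁`. Indeed, for `r ≠ p` the Sylow
`r`-subgroups of `A` are submodular in `G`, so their `r`-th powers and commutators centralize `O`
and therefore lie in `O`. -/
theorem formationResidual_le_subgroupOf [Finite G] {A O : Subgroup G} [O.Normal] {p : ℕ}
    (hp : p.Prime) (hOp : IsPGroup p O) (hi : ¬ p ∣ O.index)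
    (hc : Subgroup.centralizer (O : Set G) ≤ O) (hA : IsSubmodular A)
    (hAZ : HasSubmodularSylows A) : formationResidual IsSquarefreeA A ≤ O.subgroupOf A := by
  have := Fact.mk hp
  have hn : (O.subgroupOf A).Normal := inferInstance
  refine sInf_le ⟨hn, ?_⟩
  let f : A →* A ⧸ O.subgroupOf A := QuotientGroup.mk' (O.subgroupOf A)
  have hf : Function.Surjective f := QuotientGroup.mk'_surjective _
  have hf1 : ∀ a : A, f a = 1 ↔ (a : G) ∈ O := fun a => QuotientGroup.eq_one_iff a
  have key : ∀ r : ℕ, r.Prime → ∀ T : Sylow r (A ⧸ O.subgroupOf A), ∀ x ∈ T, x ^ r = 1 ∧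
      ∀ y ∈ T, x * y * x⁻¹ * y⁻¹ = 1 := by
    intro r hr T
    have := Fact.mk hr
    obtain ⟨S, rfl⟩ := Sylow.mapSurjective_surjective hf r T
    rintro _ ⟨a, ha, rfl⟩
    have hSr : IsPGroup r ((S : Subgroup A).map A.subtype) := S.isPGroup'.map _
    by_cases hrp : r = p
    · subst hrp
      have hle : (S : Subgroup A).map A.subtype ≤ O :=
        Subgroup.le_of_isPGroup_of_not_dvd_index hp hSr hi
      have h1 : f a = 1 := (hf1 a).2 (hle ⟨a, ha, rfl⟩)
      refine ⟨by rw [h1, one_pow], fun y _ => by rw [h1]; group⟩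
    · have hS := (hAZ r hr S).map_subtype hA
      have hO : ∀ e, IsPowerOrCommutator r ((S : Subgroup A).map A.subtype) e → e ∈ O :=
        fun e he => hc (Subgroup.mem_centralizer_iff.2 fun z hz =>
          (hS.commute_of_isPowerOrCommutator hp hr (Ne.symm hrp) hOp hSr he z hz).eq.symm)
      constructor
      · rw [← map_pow, hf1]
        obtain ⟨k, hk⟩ := S.isPGroup' ⟨a, ha⟩
        refine hO _ (Or.inl ⟨a, ⟨a, ha, rfl⟩, ⟨k, ?_⟩, rfl⟩)
        exact congrArg (fun z : S => ((z : A) : G)) hk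
      · rintro _ ⟨b, hb, rfl⟩
        rw [← map_inv, ← map_inv, ← map_mul, ← map_mul, ← map_mul, hf1]
        exact hO _ (Or.inr ⟨a, ⟨a, ha, rfl⟩, b, ⟨b, hb, rfl⟩, rfl⟩)
  refine ⟨fun r hr T x hx y hy =>
    mul_inv_eq_iff_eq_mul.1 (mul_inv_eq_one.1 ((key r hr T x hx).2 y hy)), ?_⟩
  rw [Nat.squarefree_iff_prime_squarefree]
  intro r hr hd
  have := Fact.mk hr
  obtain ⟨x, hx⟩ := hr.exists_orderOf_eq_pow_factorization_exponent (A ⧸ O.subgroupOf A)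
  set v := (Monoid.exponent (A ⧸ O.subgroupOf A)).factorization r
  have hv : 2 ≤ v := by
    refine (hr.pow_dvd_iff_le_factorization Monoid.exponent_ne_zero_of_finite).1 ?_
    rwa [pow_two]
  have hxp : IsPGroup r (Subgroup.zpowers x) := IsPGroup.of_card (n := v) (by
    rw [Nat.card_zpowers, hx])
  obtain ⟨T, hT⟩ := hxp.exists_le_sylow
  have h1 := orderOf_dvd_of_pow_eq_one (key r hr T x (hT (Subgroup.mem_zpowers x))).1
  rw [hx] at h1
  have h2 := (Nat.pow_dvd_pow_iff_le_right hr.one_lt).1 (h1.trans (pow_one r).symm.dvd)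
  omega

theorem isSubmodular_sylow_of_not_dvd_index [Finite G] {A : Subgroup G} (hA : IsSubmodular A)
    (hAZ : HasSubmodularSylows A) {q : ℕ} (hq : q.Prime) (hqA : ¬ q ∣ A.index) (Q : Sylow q G) :
    IsSubmodular (Q : Subgroup G) := by
  have := Fact.mk hq
  let S : Sylow q A := default
  refine isSubmodular_sylow_of_isSubmodular hq (S.isPGroup'.map A.subtype) ?_
    ((hAZ q hq S).map_subtype hA) Q
  rw [Subgroup.index_map_subtype]
  exact fun h => (hq.dvd_mul.1 h).elim S.not_dvd_index hqA

/-- If `A` is submodular with submodular Sylow subgroups, a Sylow subgroup of `A` for the largest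
prime divisor `p` of `|G|` lies in a normal `p`-subgroup `O` of `G`, so `p` does not divide
`|A : A ⊓ O|`. -/
theorem exists_normal_isPGroup_not_dvd_relIndex [Finite G] {A : Subgroup G} (hA : IsSubmodular A)
    (hAZ : HasSubmodularSylows A) {p : ℕ} (hp : p.Prime)
    (hmax : ∀ r, r.Prime → r ∣ Nat.card G → r ≤ p) :
    ∃ O : Subgroup G, O.Normal ∧ IsPGroup p O ∧ ¬ p ∣ O.relIndex A := by
  have := Fact.mk hp
  let S : Sylow p A := default
  obtain ⟨O, hO, hOp, hle⟩ := ((hAZ p hp S).map_subtype hA).exists_normal_isPGroup_ge hp hmax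
    (S.isPGroup'.map A.subtype)
  exact ⟨O, hO, hOp, fun h => S.not_dvd_index
    (h.trans (Subgroup.index_dvd_of_le (Subgroup.map_le_iff_le_comap.1 hle)))⟩

/-- The theorem with the order of `G` as an explicit parameter, for induction. -/
theorem hasSubmodularSylows_of_card_eq (n : ℕ) : ∀ {G : Type u} [Group G] [Finite G],
    Nat.card G = n → ∀ A B : Subgroup G, (A : Set G) * (B : Set G) = Set.univ →
    IsSubmodular A → IsSubmodular B → HasSubmodularSylows A → HasSubmodularSylows B →
    (Nat.Coprime (A ⊔ fittingSubgroup G).index (B ⊔ fittingSubgroup G).index ∨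
      Nat.Coprime (Nat.card (A ⧸ formationResidual IsSquarefreeA A))
        (Nat.card (B ⧸ formationResidual IsSquarefreeA B))) → HasSubmodularSylows G := by
  induction n using Nat.strong_induction_on with
  | _ n ih =>
  intro G _ _ hn A B hAB hA hB hAZ hBZ h
  by_cases h1 : Nat.card G = 1
  · have := (Nat.card_eq_one_iff_unique.1 h1).1
    intro q _ Q
    rw [Subsingleton.elim (Q : Subgroup G) ⊤]
    exact IsSubmodular.of_normal
  have hquot : ∀ (N : Subgroup G) [N.Normal], N ≠ ⊥ → HasSubmodularSylows (G ⧸ N) := by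
    intro N _ hN
    let f := QuotientGroup.mk' N
    have hf : Function.Surjective f := QuotientGroup.mk'_surjective N
    have hcard : Nat.card (G ⧸ N) < n := by
      rw [← hn, N.card_eq_card_quotient_mul_card_subgroup]
      exact lt_mul_of_one_lt_right Nat.card_pos (N.one_lt_card_iff_ne_bot.2 hN)
    refine ih _ hcard rfl (A.map f) (B.map f) ?_ (hA.map hf) (hB.map hf)
      (hAZ.of_surjective (f.subgroupMap_surjective A))
      (hBZ.of_surjective (f.subgroupMap_surjective B)) ?_
    · rw [Subgroup.coe_map, Subgroup.coe_map, ← Set.image_mul, hAB, Set.image_univ,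
        hf.range_eq]
    · have hindex : ∀ X : Subgroup G, (X.map f ⊔ fittingSubgroup (G ⧸ N)).index ∣
          (X ⊔ fittingSubgroup G).index := fun X => by
        refine (Subgroup.index_dvd_of_le ?_).trans
          (Subgroup.index_map_dvd (X ⊔ fittingSubgroup G) hf)
        rw [Subgroup.map_sup]
        exact sup_le_sup_left (map_fittingSubgroup_le hf) _
      refine h.imp (fun h => (h.coprime_dvd_left (hindex A)).coprime_dvd_right (hindex B))
        fun h => ?_
      exact (h.coprime_dvd_left
        (card_quotient_formationResidual_dvd (f.subgroupMap_surjective A))).coprime_dvd_right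
        (card_quotient_formationResidual_dvd (f.subgroupMap_surjective B))
  obtain ⟨p, hpd, hmax⟩ := (Nat.card G).primeFactors.exists_max_image id
    (Nat.nonempty_primeFactors.2 (by have := Nat.card_pos (α := G); omega))
  obtain ⟨hp, hpG, hG0⟩ := Nat.mem_primeFactors.1 hpd
  replace hmax : ∀ r, r.Prime → r ∣ Nat.card G → r ≤ p :=
    fun r hr hd => hmax r (Nat.mem_primeFactors.2 ⟨hr, hd, hG0⟩)
  obtain ⟨O, hO, hOp, hOi⟩ : ∃ O : Subgroup G, O.Normal ∧ IsPGroup p O ∧ ¬ p ∣ O.index := by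
    obtain ⟨U, hU, hUp, hUi⟩ := exists_normal_isPGroup_not_dvd_relIndex hA hAZ hp hmax
    obtain ⟨V, hV, hVp, hVi⟩ := exists_normal_isPGroup_not_dvd_relIndex hB hBZ hp hmax
    refine ⟨U ⊔ V, inferInstance, hUp.to_sup_of_normal_right hVp, fun h => ?_⟩
    rcases hp.dvd_mul.1 (h.trans (Subgroup.index_dvd_relIndex_mul_relIndex hAB)) with h | h
    · exact hVi (h.trans (Subgroup.relIndex_dvd_of_le_left B le_sup_right))
    · exact hUi (h.trans (Subgroup.relIndex_dvd_of_le_left A le_sup_left))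
  have hOcard : ∀ q : ℕ, q.Prime → q ≠ p → ∀ X : Subgroup G, IsPGroup p X →
      ¬ q ∣ Nat.card X := by
    intro q hq hqp X hX hd
    have := Fact.mk hp
    obtain ⟨k, hk⟩ := IsPGroup.iff_card.1 hX
    rw [hk] at hd
    exact hqp ((Nat.prime_dvd_prime_iff_eq hq hp).1 (hq.dvd_of_dvd_pow hd))
  have hOZ := hquot O (by rintro rfl; rw [Subgroup.index_bot] at hOi; exact hOi hpG)
  by_cases hK : ∃ K : Subgroup G, K.Normal ∧ K ≠ ⊥ ∧ ¬ p ∣ Nat.card K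
  · obtain ⟨K, hKn, hKb, hKp⟩ := hK
    have := Fact.mk hp
    obtain ⟨k, hk⟩ := IsPGroup.iff_card.1 hOp
    exact HasSubmodularSylows.of_inf_eq_bot (Subgroup.disjoint_of_coprime_natCard (by
      rw [hk]; exact Nat.Coprime.pow_left _ ((Nat.Prime.coprime_iff_not_dvd hp).2 hKp))).eq_bot
      hOZ (hquot K hKb)
  have hbot : ∀ K : Subgroup G, K.Normal → ¬ p ∣ Nat.card K → K = ⊥ := fun K hn hd => by
    by_contra hb
    exact hK ⟨K, hn, hb, hd⟩
  have hc : Subgroup.centralizer (O : Set G) ≤ O := by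
    by_contra hc
    exact hK (Subgroup.exists_normal_not_dvd_card hp hOp hOi hc)
  intro q hq Q
  by_cases hqp : q = p
  · subst hqp
    exact isSubmodular_sylow_of_isSubmodular hq hOp hOi IsSubmodular.of_normal Q
  suffices hs : ¬ (q ∣ A.index ∧ q ∣ B.index) by
    by_cases hqA : q ∣ A.index
    · exact isSubmodular_sylow_of_not_dvd_index hB hBZ hq (fun hqB => hs ⟨hqA, hqB⟩) Q
    · exact isSubmodular_sylow_of_not_dvd_index hA hAZ hq hqA Q
  rintro ⟨hqA, hqB⟩
  rcases h with h | h
  · have key : ∀ X : Subgroup G, q ∣ X.index → q ∣ (X ⊔ fittingSubgroup G).index := by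
      intro X hX
      rw [← Subgroup.relIndex_mul_index (le_sup_left : X ≤ X ⊔ O)] at hX
      refine ((hq.dvd_mul.1 hX).resolve_left fun hd => ?_).trans (Subgroup.index_dvd_of_le
        (sup_le_sup_left (fittingSubgroup_le_of_forall_eq_bot hp hOi hbot) X))
      exact hOcard q hq hqp O hOp (hd.trans (Subgroup.relIndex_sup_dvd_card X O))
    exact Nat.not_coprime_of_dvd_of_dvd hq.one_lt (key A hqA) (key B hqB) h
  · have key : ∀ X Y : Subgroup G, (Y : Set G) * (X : Set G) = Set.univ → IsSubmodular Y →
        HasSubmodularSylows Y → q ∣ X.index →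
        q ∣ Nat.card (Y ⧸ formationResidual IsSquarefreeA Y) := by
      intro X Y hYX hY hYZ hX
      rw [← Subgroup.relIndex_eq_index_of_mul_eq_univ hYX le_rfl] at hX
      have h2 := hX.trans (Subgroup.relIndex_dvd_card X Y)
      rw [← (O.subgroupOf Y).card_mul_index] at h2
      refine ((hq.dvd_mul.1 h2).resolve_left fun hd => ?_).trans
        (Subgroup.index_dvd_of_le (formationResidual_le_subgroupOf hp hOp hOi hc hY hYZ))
      rw [← Subgroup.card_map_of_injective Y.subtype_injective] at hd
      exact hOcard q hq hqp _ (hOp.comap_subtype.map _) hd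
    exact Nat.not_coprime_of_dvd_of_dvd hq.one_lt
      (key B A hAB hA hAZ hqB) (key A B (Subgroup.mul_eq_univ_symm hAB) hB hBZ hqA) h

end

theorem theorem1 {G : Type u} [Group G] [Finite G] (A B : Subgroup G)
    (hAB : (A : Set G) * (B : Set G) = Set.univ)
    (hA : IsSubmodular A) (hB : IsSubmodular B)
    (hAZ : HasSubmodularSylows A) (hBZ : HasSubmodularSylows B)
    (h : Nat.Coprime (A ⊔ fittingSubgroup G).index (B ⊔ fittingSubgroup G).index ∨
      Nat.Coprime (Nat.card (A ⧸ formationResidual IsSquarefreeA A))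
        (Nat.card (B ⧸ formationResidual IsSquarefreeA B))) :
    HasSubmodularSylows G :=
  hasSubmodularSylows_of_card_eq _ rfl A B hAB hA hB hAZ hBZ h
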